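/- **Model.** A principal can allocate an asset to a single agent. The agent's type $\theta$ is drawn from a distribution $F$ with a continuous density $f$ on $\Theta=[\underline\theta,\bar\theta]$, $\underline\theta<\bar\theta$, that is positive inside $\Theta$ (it may vanish at the endpoints). Errors are additive: if the agent gets the asset, his income is $\pi=\theta+\varepsilon$, where $\varepsilon$ is independent of $\theta$, integrable, of mean zero, and has a continuous density, positive inside its support $[\underline\varepsilon,\bar\varepsilon]$, with $-\underline\theta\le\underline\varepsilon<0<\bar\varepsilon\le\infty$. Write $G(\pi|\theta)$ and $g(\pi|\theta)$ for the distribution function and the density of income given the type, $G_2=\partial G/\partial\theta$, $\Pi(\theta)=[\theta+\underline\varepsilon,\theta+\bar\varepsilon]$ and $\Pi=\bigcup_\theta\Pi(\theta)$. An audit costs $c\ge 0$, and $\phi\in[0,1]$ is given. A direct mechanism $(q,t,r,a,p)$ consists of (measurable) allocation, transfer, royalty, auditing and penalty rules $q(\theta')\in[0,1]$, $t(\theta')\in\mathbf R$, $r(\theta',\pi')\in\mathbf R$, $a(\theta',\pi')\in[0,1]$, $p(\theta',\pi',\pi)\in\mathbf R$, for reports $\theta'\in\Theta$, $\pi'\in\Pi(\theta')$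 and realized income $\pi\in\Pi$. Let $u(\theta',\pi'|\pi)=q(\theta')\,(\pi-r(\theta',\pi')-a(\theta',\pi')p(\theta',\pi',\pi))$ and $U(\theta'|\theta)=\mathbf E_{\pi|\theta}[u(\theta',\mathrm{proj}_{\Pi(\theta')}\pi\,|\,\pi)]$, where $\mathrm{proj}_{\Pi(\theta')}\pi$ is the point of $\Pi(\theta')$ closest to $\pi$. The mechanism is feasible if * $0\le p(\theta',\pi',\hat\pi)-p(\theta',\pi',\pi)\le(\hat\pi-\pi)\phi$ for all $\hat\pi>\pi$ in $\Pi$; * $u(\theta,\pi|\pi)\ge u(\theta,\pi'|\pi)$ for all $\theta\in\Theta$ and $\pi,\pi'\in\Pi(\theta)$; * $U(\theta|\theta)-t(\theta)\ge U(\theta'|\theta)-t(\theta')$ and $U(\theta|\theta)-t(\theta)\ge 0$ for all $\theta,\theta'\in\Theta$. It is optimal if it maximizes $\mathbf E_\theta\big[t(\theta)+q(\theta)\,\mathbf E_{\pi|\theta}[r(\theta,\pi)+a(\theta,\pi)(p(\theta,\pi,\pi)-c)]\big]$ among all feasible mechanisms. Let $\mu(\theta,\pi)=-\frac{G_2(\pi|\theta)}{g(\pi|\theta)}\cdot\frac{1-F(\theta)}{f(\theta)}$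 and $\psi(\theta)=\theta-\frac{1-F(\theta)}{f(\theta)}+\mathbf E_{\pi|\theta}[(\mu(\theta,\pi)\phi-c)_+]$. Assume that, in the interior, $\mu(\theta,\pi)\phi-c$ is single-crossing from above in $\theta$ and in $\pi$, and that $\psi$ is strictly increasing. (A function $k$ is single-crossing from above if, for $z<z'$, $k(z)\le 0$ implies $k(z')\le 0$ and $k(z)<0$ implies $k(z')<0$.) Let $[\,\cdot\,]$ denote the indicator of a predicate, and put $\pi^*(\theta)=0\vee\sup\{\pi\in\Pi(\theta):\mu(\theta,\pi)\phi\ge c\}\in[0,\infty]$, $\Phi(\theta)=-\phi\int_0^{\pi^*(\theta)}G_2(\pi|\theta)\,d\pi$, and $$q^*(\theta)=[\psi(\theta)>0],\quad a^*(\theta,\pi')=[\pi'\le\pi^*(\theta)],\quad r^*(\theta,\pi')=\min\{\pi',\pi^*(\theta)\}\phi,\quad p^*(\theta,\pi',\pi)=(\pi-\pi')\phi,$$ $$t^*(\theta)=q^*(\theta)\,\mathbf E_{\pi|\theta}[\pi-r^*(\theta,\pi)]-\int_{\underline\theta}^{\theta}q^*(z)(1-\Phi(z))\,dz,$$ where $q^*(\underline\theta)=0$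 if $f(\underline\theta)=0$, and $(1-F(\bar\theta))/f(\bar\theta)$ is read as $0$. Define the cutoff types $$\theta^*=\sup\Big\{\theta\in\Theta:\tfrac{1-F(\theta)}{f(\theta)}\phi-c\ge 0\Big\},\qquad \theta_0=\inf\Big\{\theta\in\Theta:\theta-\tfrac{1-F(\theta)}{f(\theta)}+\Big(\tfrac{1-F(\theta)}{f(\theta)}\phi-c\Big)_+>0\Big\},$$ where $\theta$ ranges over the interior of $\Theta$ and $\theta^*=\underline\theta$ if the first set is empty. **Statement (binary menu).** The mechanism $(q^*,t^*,r^*,a^*,p^*)$ is optimal, and it can be implemented by offering the agent a menu of at most two contracts: * if $\theta_0\ge\theta^*$, the single lump-sum contract (no royalties, no auditing) at price $\theta_0$; * if $\theta_0<\theta^*$, the lump-sum contract at price $(1-\phi)\theta_0+\phi\theta^*$ and a contract at price $(1-\phi)\theta_0$ with linear royalties $\pi'\phi$, certain auditing and penalties $(\pi-\pi')\phi$. Here "implemented" means the following. It is optimal for every type, when he may choose any contract of the menu or the outside option $0$, to buy nothing if $\theta\le\theta_0$, to buy the linear-royalty contract if $\theta_0<\theta\le\theta^*$, to buy the lump-sum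 contract if $\theta>\max\{\theta_0,\theta^*\}$, and always to report his income truthfully. Under these choices every type $\theta>\underline\theta$ gets exactly what $(q^*,t^*,r^*,a^*,p^*)$ prescribes: the asset with the same probability, at the same price, with the same royalty and audit probability after every income report in $\Pi(\theta)$, and the same penalties whenever he is audited. -/

import Mathlib

open Set MeasureTheory

noncomputable section

/-- The model with a single agent. The agent's type is drawn from `[θlo, θhi]` with density `f`.
If an agent of type `θ` gets the asset, his income is drawn from
`Π(θ) = [πlo θ, πhi θ]` (`πhi θ = ∞` is allowed, and then the interval is a half-line) with density
`g θ`. Densities are continuous on their interval and positive inside it; they may vanish at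
endpoints. An audit costs the principal `c`, and `φ` is the maximal sensitivity of penalties
to realized income. Types are normalized so that the expected income of type `θ` is `θ`.
(Smoothness of the distribution of income in the type is not listed here: under
additive errors, whatever is needed of it follows.) -/
structure AuctionModel where
  θlo : ℝ
  θhi : ℝ
  f : ℝ → ℝ
  πlo : ℝ → ℝ
  πhi : ℝ → EReal
  g : ℝ → ℝ → ℝ
  c : ℝ
  φ : ℝ
  θlo_lt_θhi : θlo < θhi
  f_continuousOn : ContinuousOn f (Icc θlo θhi)
  f_pos : ∀ θ ∈ Ioo θlo θhi, 0 < f θ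
  f_eq_zero : ∀ θ, θ ∉ Icc θlo θhi → f θ = 0
  f_integral : ∫ θ, f θ = 1
  πlo_nonneg : ∀ θ ∈ Icc θlo θhi, 0 ≤ πlo θ
  πlo_lt_πhi : ∀ θ ∈ Icc θlo θhi, (πlo θ : EReal) < πhi θ
  g_continuousOn : ∀ θ ∈ Icc θlo θhi, ContinuousOn (g θ) {π : ℝ | πlo θ ≤ π ∧ (π : EReal) ≤ πhi θ}
  g_pos : ∀ θ ∈ Icc θlo θhi, ∀ π : ℝ, πlo θ < π → (π : EReal) < πhi θ → 0 < g θ π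
  g_eq_zero : ∀ θ ∈ Icc θlo θhi, ∀ π : ℝ, ¬ (πlo θ ≤ π ∧ (π : EReal) ≤ πhi θ) → g θ π = 0
  g_integral : ∀ θ ∈ Icc θlo θhi, ∫ π, g θ π = 1
  income_integrable : ∀ θ ∈ Icc θlo θhi, Integrable (fun π => π * g θ π)
  income_mean : ∀ θ ∈ Icc θlo θhi, ∫ π, π * g θ π = θ
  c_nonneg : 0 ≤ c
  φ_mem : φ ∈ Icc (0 : ℝ) 1

/-- A direct mechanism with one agent: allocation rule `q θ'`, upfront transfer rule `t θ'`,
royalty rule `r θ' π'`, auditing rule `a θ' π'`, penalty rule `p θ' π' π`, where `θ'` is the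
reported type, `π'` the reported income and `π` the realized income. Only the values at
`θ' ∈ Θ`, `π' ∈ Π(θ')`, `π ∈ Π` matter. -/
structure DirectMechanism where
  q : ℝ → ℝ
  t : ℝ → ℝ
  r : ℝ → ℝ → ℝ
  a : ℝ → ℝ → ℝ
  p : ℝ → ℝ → ℝ → ℝ

namespace AuctionModel

variable (M : AuctionModel)

/-- The type space `Θ`. -/
def types : Set ℝ := Icc M.θlo M.θhi

/-- The support `Π(θ)` of the income of type `θ`. -/
def incomes (θ : ℝ) : Set ℝ := {π : ℝ | M.πlo θ ≤ π ∧ (π : EReal) ≤ M.πhi θ}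

/-- The open interval of incomes strictly inside `Π(θ)`. -/
def innerIncomes (θ : ℝ) : Set ℝ := {π : ℝ | M.πlo θ < π ∧ (π : EReal) < M.πhi θ}

/-- The union `Π` of the sets `Π(θ)` over all types. -/
def allIncomes : Set ℝ := ⋃ θ ∈ M.types, M.incomes θ

/-- The point of `Π(θ')` that is closest to `π`. -/
def proj (θ' π : ℝ) : ℝ := max (M.πlo θ') (min (π : EReal) (M.πhi θ')).toReal

/-- Expectation over the type. -/
def expType (X : ℝ → ℝ) : ℝ := ∫ θ, X θ * M.f θ

/-- Expectation over the income of type `θ`. -/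
def expIncome (θ : ℝ) (X : ℝ → ℝ) : ℝ := ∫ π, X π * M.g θ π

/-- The distribution function of the type. -/
def F (θ : ℝ) : ℝ := ∫ z in Iic θ, M.f z

/-- The distribution function `G(π | θ)` of income given the type. -/
def G (π θ : ℝ) : ℝ := ∫ x in Iic π, M.g θ x

/-- The partial derivative of `G(π | θ)` in the type (one-sided at the end points of `Θ`). -/
def G₂ (π θ : ℝ) : ℝ := derivWithin (fun z => M.G π z) M.types θ

/-! ### The principal's program -/

/-- Gross utility (before the upfront transfer) after type report `θ'`, income report `π'`, when
the realized income is `π`. -/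
def u (D : DirectMechanism) (θ' π' π : ℝ) : ℝ :=
  D.q θ' * (π - D.r θ' π' - D.a θ' π' * D.p θ' π' π)

/-- Expected gross utility of type `θ` who reports type `θ'` and then reports income as
truthfully as possible. -/
def U (D : DirectMechanism) (θ' θ : ℝ) : ℝ :=
  M.expIncome θ (fun π => u D θ' (M.proj θ' π) π)

/-- The principal's expected payoff under truthful reporting: payments minus auditing costs. -/
def payoff (D : DirectMechanism) : ℝ :=
  M.expType fun θ =>
    D.t θ + D.q θ * M.expIncome θ (fun π => D.r θ π + D.a θ π * (D.p θ π π - M.c))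

/-- The constraints of the principal's program. (For a mechanism that satisfies them, all the
expectations in `U` on `Θ` and in `payoff` that carry a nonzero weight `q` automatically
converge.) -/
structure IsFeasible (D : DirectMechanism) : Prop where
  q_mem : ∀ θ ∈ M.types, D.q θ ∈ Icc (0 : ℝ) 1
  a_mem : ∀ θ ∈ M.types, ∀ π' ∈ M.incomes θ, D.a θ π' ∈ Icc (0 : ℝ) 1
  q_measurable : Measurable (M.types.domRestrict D.q)
  t_measurable : Measurable (M.types.domRestrict D.t)
  r_measurable : Measurable
    ({x : ℝ × ℝ | x.1 ∈ M.types ∧ x.2 ∈ M.incomes x.1}.domRestrict fun x => D.r x.1 x.2)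
  a_measurable : Measurable
    ({x : ℝ × ℝ | x.1 ∈ M.types ∧ x.2 ∈ M.incomes x.1}.domRestrict fun x => D.a x.1 x.2)
  p_measurable : Measurable
    ({x : ℝ × ℝ × ℝ | x.1 ∈ M.types ∧ x.2.1 ∈ M.incomes x.1 ∧ x.2.2 ∈ M.allIncomes}.domRestrict
      fun x => D.p x.1 x.2.1 x.2.2)
  /-- Generalized double monotonicity. -/
  double_monotone : ∀ θ ∈ M.types, ∀ π' ∈ M.incomes θ,
    ∀ π₁ ∈ M.allIncomes, ∀ π₂ ∈ M.allIncomes, π₁ < π₂ →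
      0 ≤ D.p θ π' π₂ - D.p θ π' π₁ ∧ D.p θ π' π₂ - D.p θ π' π₁ ≤ (π₂ - π₁) * M.φ
  /-- Truthful reporting of income is optimal after a truthful report of the type. -/
  ic_income : ∀ θ ∈ M.types, ∀ π ∈ M.incomes θ, ∀ π' ∈ M.incomes θ, u D θ π' π ≤ u D θ π π
  /-- Truthful reporting of the type is optimal. -/
  ic_type : ∀ θ ∈ M.types, ∀ θ' ∈ M.types, M.U D θ' θ - D.t θ' ≤ M.U D θ θ - D.t θ
  /-- Participation is optimal. -/
  ir : ∀ θ ∈ M.types, 0 ≤ M.U D θ θ - D.t θ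

/-- `D` solves the principal's program. -/
def IsOptimal (D : DirectMechanism) : Prop :=
  M.IsFeasible D ∧ ∀ D', M.IsFeasible D' → M.payoff D' ≤ M.payoff D

/-! ### Virtual values and the regularity assumption -/

/-- The inverse hazard rate `(1 - F) / f`. It is `0` at the highest type (also if the density
vanishes there), and it is not meaningful at the lowest type if the density vanishes there. -/
def invHazard (θ : ℝ) : ℝ := (1 - M.F θ) / M.f θ

/-- The coefficient `μ(θ, π)`. -/
def μ (θ π : ℝ) : ℝ := -(M.G₂ π θ / M.g θ π) * M.invHazard θ

/-- The virtual value `ψ(θ)`. -/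
def ψ (θ : ℝ) : ℝ :=
  θ - M.invHazard θ + M.expIncome θ (fun π => max (M.μ θ π * M.φ - M.c) 0)

/-- The regularity assumption: `μ φ - c` is single-crossing from above in the type and in the
income (on the open region where `μ` is defined), and `ψ` is strictly increasing. -/
structure Regular : Prop where
  crossing_type : ∀ θ₁ ∈ Ioo M.θlo M.θhi, ∀ θ₂ ∈ Ioo M.θlo M.θhi, θ₁ < θ₂ →
    ∀ π ∈ M.innerIncomes θ₁ ∩ M.innerIncomes θ₂,
      (M.μ θ₁ π * M.φ - M.c ≤ 0 → M.μ θ₂ π * M.φ - M.c ≤ 0) ∧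
      (M.μ θ₁ π * M.φ - M.c < 0 → M.μ θ₂ π * M.φ - M.c < 0)
  crossing_income : ∀ θ ∈ Ioo M.θlo M.θhi, ∀ π₁ ∈ M.innerIncomes θ, ∀ π₂ ∈ M.innerIncomes θ,
    π₁ < π₂ →
      (M.μ θ π₁ * M.φ - M.c ≤ 0 → M.μ θ π₂ * M.φ - M.c ≤ 0) ∧
      (M.μ θ π₁ * M.φ - M.c < 0 → M.μ θ π₂ * M.φ - M.c < 0)
  ψ_strictMono : StrictMonoOn M.ψ (Ioo M.θlo M.θhi)

/-- Additive errors: income is `π = θ + ε`, where `ε` is independent of the type, has mean zero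
and has a continuous density `h` that is positive on its support `[εlo, εhi]` (`εhi = ∞` is
allowed, and `h` may vanish at end points). -/
structure AdditiveErrors (εlo : ℝ) (εhi : EReal) (h : ℝ → ℝ) : Prop where
  εlo_ge : -M.θlo ≤ εlo
  εlo_neg : εlo < 0
  εhi_pos : 0 < εhi
  h_continuousOn : ContinuousOn h {ε : ℝ | εlo ≤ ε ∧ (ε : EReal) ≤ εhi}
  h_pos : ∀ ε : ℝ, εlo < ε → (ε : EReal) < εhi → 0 < h ε
  h_eq_zero : ∀ ε : ℝ, ¬ (εlo ≤ ε ∧ (ε : EReal) ≤ εhi) → h ε = 0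
  h_integral : ∫ ε, h ε = 1
  error_integrable : Integrable (fun ε => ε * h ε)
  error_mean : ∫ ε, ε * h ε = 0
  πlo_eq : ∀ θ ∈ M.types, M.πlo θ = θ + εlo
  πhi_eq : ∀ θ ∈ M.types, M.πhi θ = (θ : EReal) + εhi
  g_eq : ∀ θ ∈ M.types, ∀ π, M.g θ π = h (π - θ)

/-! ### The optimal mechanism -/

/-- The auditing threshold `π*(θ) = 0 ∨ sup {π : μ(θ, π) φ ≥ c}`, possibly `∞`. -/
def πStar (θ : ℝ) : EReal :=
  max 0 (sSup ((fun π : ℝ => (π : EReal)) '' {π ∈ M.innerIncomes θ | M.c ≤ M.μ θ π * M.φ}))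

/-- The function `Φ(θ) = -φ ∫_0^{π*(θ)} G₂(π | θ) dπ`. -/
def Φ (θ : ℝ) : ℝ := -M.φ * ∫ π in {π : ℝ | 0 < π ∧ (π : EReal) ≤ M.πStar θ}, M.G₂ π θ

/-- The asset is allocated if and only if the virtual value is positive. (If the density vanishes
at the lowest type, the virtual value does not exist there, and the asset is not allocated.) -/
def qStar (θ : ℝ) : ℝ := if 0 < M.ψ θ ∧ ¬ (θ = M.θlo ∧ M.f θ = 0) then 1 else 0

/-- Royalties at rate `φ` up to the cap `π*(θ) φ`. -/
def rStar (θ π' : ℝ) : ℝ := (min (π' : EReal) (M.πStar θ)).toReal * M.φ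

/-- The winner is audited if and only if his reported income is at most `π*(θ)`. (The tie
`π' = π*(θ)` has probability zero under truthful reporting. It has to be audited when `π*(θ)` is
the largest possible income of type `θ`: a higher type who pretends to be `θ` reports exactly
this income whenever his realized income exceeds it.) -/
def aStar (θ π' : ℝ) : ℝ := if (π' : EReal) ≤ M.πStar θ then 1 else 0

/-- The penalty is the underpaid royalty. -/
def pStar (_θ π' π : ℝ) : ℝ := (π - π') * M.φ

/-- The upfront transfer. -/
def tStar (θ : ℝ) : ℝ :=
  M.qStar θ * M.expIncome θ (fun π => π - M.rStar θ π)
    - ∫ z in M.θlo..θ, M.qStar z * (1 - M.Φ z)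

/-- The mechanism `(q*, t*, r*, a*, p*)`. -/
def star : DirectMechanism where
  q := M.qStar
  t := M.tStar
  r := M.rStar
  a := M.aStar
  p := M.pStar

/-! ### Cutoff types -/

/-- The cutoff `θ* = sup {θ : φ (1 - F(θ)) / f(θ) - c ≥ 0}`; it is the lowest type if no type in
the interior of `Θ` satisfies the inequality. -/
def θStar : ℝ := sSup (insert M.θlo {θ ∈ Ioo M.θlo M.θhi | 0 ≤ M.invHazard θ * M.φ - M.c})

/-- The cutoff `θ₀ = inf {θ : θ - (1 - F(θ)) / f(θ) + (φ (1 - F(θ)) / f(θ) - c)₊ > 0}`. -/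
def θZero : ℝ :=
  sInf {θ ∈ Ioo M.θlo M.θhi | 0 < θ - M.invHazard θ + max (M.invHazard θ * M.φ - M.c) 0}

end AuctionModel

/-! ### Menus of contracts -/

/-- A contract for the asset: the upfront price, the royalty as a function of reported income,
the auditing probability as a function of reported income, and the penalty after an
audit as a function of reported and realized income. -/
structure RoyaltyContract where
  price : ℝ
  royalty : ℝ → ℝ
  audit : ℝ → ℝ
  penalty : ℝ → ℝ → ℝ

namespace RoyaltyContract

/-- The agent's profit from the contract if he reports `π'` and his realized income is `π`. -/
def profit (C : RoyaltyContract) (π' π : ℝ) : ℝ :=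
  π - C.price - C.royalty π' - C.audit π' * C.penalty π' π

/-- The lump-sum contract: no royalties, no auditing (hence no penalties). -/
def lumpSum (price : ℝ) : RoyaltyContract where
  price := price
  royalty _ := 0
  audit _ := 0
  penalty _ _ := 0

/-- Linear royalties at rate `φ`, certain auditing, and penalties `(π - π') φ`. -/
def linearRoyalty (φ price : ℝ) : RoyaltyContract where
  price := price
  royalty π' := π' * φ
  audit _ := 1
  penalty π' π := (π - π') * φ

end RoyaltyContract

namespace AuctionModel

variable (M : AuctionModel)

/-- Expected utility of type `θ` from a decision: a contract followed by truthful income reports,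
or the outside option `none`. -/
def decisionValue (θ : ℝ) : Option RoyaltyContract → ℝ
  | none => 0
  | some C => M.expIncome θ (fun π => C.profit π π)

/-- When the agent is offered the menu, it is optimal for every type `θ` to choose `σ θ` (a
contract from the menu, or `none`, to buy nothing), and to report every income truthfully. -/
structure IsOptimalStrategy (menu : Set RoyaltyContract) (σ : ℝ → Option RoyaltyContract) :
    Prop where
  available : ∀ θ ∈ M.types, ∀ C, σ θ = some C → C ∈ menu
  truthful : ∀ C ∈ menu, ∀ π ∈ M.allIncomes, ∀ π' ∈ M.allIncomes, C.profit π' π ≤ C.profit π π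
  outside : ∀ θ ∈ M.types, M.decisionValue θ none ≤ M.decisionValue θ (σ θ)
  contract : ∀ θ ∈ M.types, ∀ C ∈ menu, M.decisionValue θ (some C) ≤ M.decisionValue θ (σ θ)

/-- The menu, with the choices `σ`, implements the mechanism `D`: the choices `σ` with truthful
income reports are optimal for every type, and every type except possibly the lowest one (which
has probability zero) gets exactly what `D` prescribes: either no asset and no payment, or the
asset at the same price, with the same royalties and auditing after every income report, and
with the same penalties whenever an audit can take place. -/
structure Implements (menu : Set RoyaltyContract) (σ : ℝ → Option RoyaltyContract)
    (D : DirectMechanism) : Prop where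
  optimal : M.IsOptimalStrategy menu σ
  outcome_none : ∀ θ ∈ M.types, θ ≠ M.θlo → σ θ = none → D.q θ = 0 ∧ D.t θ = 0
  outcome_some : ∀ θ ∈ M.types, θ ≠ M.θlo → ∀ C, σ θ = some C →
    D.q θ = 1 ∧ D.t θ = C.price ∧
    ∀ π' ∈ M.incomes θ, D.r θ π' = C.royalty π' ∧ D.a θ π' = C.audit π' ∧
      (D.a θ π' ≠ 0 → ∀ π ∈ M.allIncomes, D.p θ π' π = C.penalty π' π)

end AuctionModel

end

/-! With additive errors `G(π|θ) = H(π - θ)`, so `-G₂ / g = 1` and `μ(θ, π)` is the inverse hazard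
rate `λ = (1 - F) / f`, whatever the income. Auditing is therefore all or nothing. If `λ φ - c ≥ 0`,
then `π*` is the top of `Π(θ)` and `Φ = φ`; otherwise both are `0`. Moreover `ψ = θ - λ + (λ φ -
c)₊`.

Upper bound. Where `q > 0`, truthful income reporting and double monotonicity make the total charge
nondecreasing in income with slope at most `φ`; starting from a report `π`, the slope upwards inside
`Π(θ)` is at most `φ a(θ, π)`. If type `θ + δ` imitates `θ`, each error yields an income higher by
`δ`, so his advantage over `θ` is at least `q (δ - φ δ (A + o(1)))`, with `A` the audit probability
of `θ`. Rents are monotone, hence differentiable almost everywhere, and there the derivative is at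
least `q (1 - φ A)`. A monotone function grows by at least the integral of its derivative, so
absolute continuity of the rent is not needed (`integral_marginalRent_le_rent`). Surplus minus rent,
after exchanging integrals, is at most `∫ f q (θ - λ + A (λ φ - c))`; maximizing pointwise over `q,
A ∈ [0, 1]` bounds it by `∫ f q* ψ`.

Attainment. The starred mechanism leaves the agent a fixed share `q* (1 - Φ)` of his income, so the
utility from imitating a type is affine in the true type. By regularity this share is, above the
lowest type, a nondecreasing step function with values among `0`, `1 - φ`, `1` and jumps at the
cutoffs (`netShare`). The rent is its integral, incentive compatibility is the subgradient
inequality of this convex function (`Regular.subgradient`), and all bounds above bind.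

Menu. The rent is piecewise affine and convex, hence the upper envelope of `0` and one or two lines.
These lines are the values of the contracts, and their intercepts give the prices. -/

namespace AuctionModel

/-- The expected gain from auditing, per unit of royalty rate: `φ (1 - F) / f - c`. -/
noncomputable def auditGain (M : AuctionModel) (θ : ℝ) : ℝ := M.invHazard θ * M.φ - M.c

/-! ### Additive errors: the virtual quantities do not depend on income -/

namespace AdditiveErrors

variable {M : AuctionModel} {εlo : ℝ} {εhi : EReal} {h : ℝ → ℝ}

theorem h_integrable (hadd : M.AdditiveErrors εlo εhi h) : Integrable h :=
  integrable_of_integral_eq_one hadd.h_integral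

theorem ae_inner_or_zero (hadd : M.AdditiveErrors εlo εhi h) :
    ∀ᵐ ε : ℝ, (εlo < ε ∧ (ε : EReal) < εhi) ∨ h ε = 0 := by
  have h1 : ∀ᵐ ε : ℝ, ε ≠ εlo := Measure.ae_ne volume εlo
  -- If `εhi = ∞`, then `toReal` is `0`; this excludes one more point, which is harmless almost
  -- everywhere.
  have h2 : ∀ᵐ ε : ℝ, ε ≠ εhi.toReal := Measure.ae_ne volume _
  filter_upwards [h1, h2] with ε h1 h2
  by_cases hε : εlo ≤ ε ∧ (ε : EReal) ≤ εhi
  · left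
    refine ⟨lt_of_le_of_ne hε.1 h1.symm, lt_of_le_of_ne hε.2 ?_⟩
    rintro rfl
    exact h2 rfl
  · exact Or.inr (hadd.h_eq_zero ε hε)

theorem ae_h_nonneg (hadd : M.AdditiveErrors εlo εhi h) : ∀ᵐ ε : ℝ, 0 ≤ h ε := by
  filter_upwards [hadd.ae_inner_or_zero] with ε hε
  rcases hε with hε | hε
  · exact (hadd.h_pos ε hε.1 hε.2).le
  · exact hε.ge

theorem θlo_pos (hadd : M.AdditiveErrors εlo εhi h) : 0 < M.θlo := by
  linarith [hadd.εlo_ge, hadd.εlo_neg]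

theorem expIncome_eq (hadd : M.AdditiveErrors εlo εhi h) {θ : ℝ} (hθ : θ ∈ M.types)
    (X : ℝ → ℝ) : M.expIncome θ X = ∫ ε, X (θ + ε) * h ε := by
  unfold expIncome
  rw [← integral_add_left_eq_self (fun π => X π * M.g θ π) θ]
  congr 1
  ext ε
  rw [hadd.g_eq θ hθ, add_sub_cancel_left]

theorem mem_incomes_iff (hadd : M.AdditiveErrors εlo εhi h) {θ : ℝ} (hθ : θ ∈ M.types)
    {ε : ℝ} : θ + ε ∈ M.incomes θ ↔ εlo ≤ ε ∧ (ε : EReal) ≤ εhi := by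
  simp only [incomes, mem_ofPred_eq, hadd.πlo_eq θ hθ, hadd.πhi_eq θ hθ]
  rw [add_le_add_iff_left, EReal.coe_add]
  refine and_congr_right fun _ => ?_
  induction εhi using EReal.rec with
  | bot => simp
  | top => simp
  | coe x => norm_cast; simp

theorem mem_innerIncomes_iff (hadd : M.AdditiveErrors εlo εhi h) {θ : ℝ} (hθ : θ ∈ M.types)
    {ε : ℝ} : θ + ε ∈ M.innerIncomes θ ↔ εlo < ε ∧ (ε : EReal) < εhi := by
  simp only [innerIncomes, mem_ofPred_eq, hadd.πlo_eq θ hθ, hadd.πhi_eq θ hθ]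
  rw [add_lt_add_iff_left, EReal.coe_add]
  refine and_congr_right fun _ => ?_
  induction εhi using EReal.rec with
  | bot => simp
  | top => simpa using EReal.coe_lt_top (θ + ε)
  | coe x => norm_cast; simp

theorem continuousAt_h (hadd : M.AdditiveErrors εlo εhi h) {ε : ℝ}
    (hε : εlo < ε ∧ (ε : EReal) < εhi ∨ ε < εlo ∨ εhi < ε) : ContinuousAt h ε := by
  rcases hε with ⟨h1, h2⟩ | hε | hε
  · refine hadd.h_continuousOn.continuousAt ?_
    have e1 : ∀ᶠ x : ℝ in nhds ε, εlo < x := eventually_gt_nhds h1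
    have e2 : ∀ᶠ x : ℝ in nhds ε, (x : EReal) < εhi :=
      (continuous_coe_real_ereal.tendsto ε).eventually_lt_const h2
    filter_upwards [e1, e2] with x h1 h2
    exact ⟨h1.le, h2.le⟩
  · have e1 : h =ᶠ[nhds ε] fun _ => 0 := by
      filter_upwards [eventually_lt_nhds hε] with x hx
      exact hadd.h_eq_zero x fun hx' => absurd hx (not_lt.2 hx'.1)
    exact continuousAt_const.congr e1.symm
  · have e1 : h =ᶠ[nhds ε] fun _ => 0 := by
      filter_upwards [(continuous_coe_real_ereal.tendsto ε).eventually_const_lt hε] with x hx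
      exact hadd.h_eq_zero x fun hx' => absurd hx (not_lt.2 hx'.2)
    exact continuousAt_const.congr e1.symm

theorem G_eq (hadd : M.AdditiveErrors εlo εhi h) {θ : ℝ} (hθ : θ ∈ M.types) (π : ℝ) :
    M.G π θ = ∫ ε in Iic (π - θ), h ε := by
  unfold G
  rw [← integral_indicator measurableSet_Iic, ← integral_indicator measurableSet_Iic,
    ← integral_add_left_eq_self _ θ]
  congr 1
  ext ε
  simp only [indicator, mem_Iic, hadd.g_eq θ hθ, add_sub_cancel_left]
  congr 1
  exact propext (by constructor <;> intro <;> linarith)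

/-- The distribution function is a primitive of `h` evaluated at `π - θ`, so this is the fundamental
theorem of calculus. Continuity has to be assumed because `h` may jump at the ends of its support.
-/
theorem G₂_eq (hadd : M.AdditiveErrors εlo εhi h) {θ : ℝ} (hθ : θ ∈ M.types) {π : ℝ}
    (hπ : ContinuousAt h (π - θ)) : M.G₂ π θ = -h (π - θ) := by
  have hint := hadd.h_integrable
  have hH : HasDerivAt (fun x => ∫ ε in Iic x, h ε) (h (π - θ)) (π - θ) := by
    have e : (fun x => ∫ ε in Iic x, h ε) =
        fun x => (∫ ε in Iic (0 : ℝ), h ε) + ∫ ε in (0 : ℝ)..x, h ε := by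
      ext x
      rw [← intervalIntegral.integral_Iic_sub_Iic hint.integrableOn hint.integrableOn]
      ring
    rw [e]
    exact (intervalIntegral.integral_hasDerivAt_right hint.intervalIntegrable
      (hint.aestronglyMeasurable.stronglyMeasurableAtFilter) hπ).const_add _
  have hd : HasDerivAt (fun z => ∫ ε in Iic (π - z), h ε) (-h (π - θ)) θ := by
    exact hH.comp_const_sub π θ
  unfold G₂
  rw [derivWithin_congr (fun z hz => hadd.G_eq hz π) (hadd.G_eq hθ π)]
  exact hd.hasDerivWithinAt.derivWithin (uniqueDiffOn_Icc M.θlo_lt_θhi θ hθ)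

theorem ae_G₂_eq (hadd : M.AdditiveErrors εlo εhi h) {θ : ℝ} (hθ : θ ∈ M.types) :
    ∀ᵐ π : ℝ, M.G₂ π θ = -h (π - θ) := by
  have h1 : ∀ᵐ π : ℝ, π ≠ θ + εlo := Measure.ae_ne volume _
  have h2 : ∀ᵐ π : ℝ, π ≠ θ + εhi.toReal := Measure.ae_ne volume _
  filter_upwards [h1, h2] with π h1 h2
  refine hadd.G₂_eq hθ (hadd.continuousAt_h ?_)
  rcases lt_trichotomy (π - θ) εlo with h3 | h3 | h3
  · exact Or.inr (Or.inl h3)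
  · exact absurd (by linarith) h1
  rcases lt_trichotomy ((π - θ : ℝ) : EReal) εhi with h4 | h4 | h4
  · exact Or.inl ⟨h3, h4⟩
  · refine absurd ?_ h2
    rw [← h4, EReal.toReal_coe]
    ring
  · exact Or.inr (Or.inr h4)

/-- A shift family has `-G₂ = g`, so the factor in front of the inverse hazard rate is `1`. This
independence of income is what makes the menu binary. -/
theorem μ_eq (hadd : M.AdditiveErrors εlo εhi h) {θ : ℝ} (hθ : θ ∈ M.types) {π : ℝ}
    (hπ : π ∈ M.innerIncomes θ) : M.μ θ π = M.invHazard θ := by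
  have h1 : θ + (π - θ) ∈ M.innerIncomes θ := by simpa using hπ
  rw [hadd.mem_innerIncomes_iff hθ] at h1
  have h2 := hadd.h_pos _ h1.1 h1.2
  unfold μ
  rw [hadd.G₂_eq hθ (hadd.continuousAt_h (Or.inl h1)), hadd.g_eq θ hθ, neg_div, neg_neg,
    div_self h2.ne', one_mul]

theorem self_mem_innerIncomes (hadd : M.AdditiveErrors εlo εhi h) {θ : ℝ} (hθ : θ ∈ M.types) :
    θ ∈ M.innerIncomes θ := by
  simpa using (hadd.mem_innerIncomes_iff hθ (ε := 0)).2 ⟨hadd.εlo_neg, by simpa using hadd.εhi_pos⟩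

theorem πStar_of_nonneg (hadd : M.AdditiveErrors εlo εhi h) {θ : ℝ} (hθ : θ ∈ M.types)
    (hk : 0 ≤ M.auditGain θ) : M.πStar θ = M.πhi θ := by
  have hs : {π ∈ M.innerIncomes θ | M.c ≤ M.μ θ π * M.φ} = M.innerIncomes θ := by
    ext π
    simp only [mem_ofPred_eq, and_iff_left_iff_imp]
    intro hπ
    rw [hadd.μ_eq hθ hπ]
    unfold auditGain at hk
    linarith
  have hmem := hadd.self_mem_innerIncomes hθ
  have hsup : sSup ((fun π : ℝ => (π : EReal)) '' M.innerIncomes θ) = M.πhi θ := by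
    refine le_antisymm (sSup_le ?_) (le_of_forall_lt fun y hy => ?_)
    · rintro _ ⟨π, hπ, rfl⟩
      exact hπ.2.le
    · obtain ⟨z, hz1, hz2⟩ := EReal.lt_iff_exists_real_btwn.1 (max_lt hy hmem.2)
      have hz3 := max_lt_iff.1 hz1
      refine hz3.1.trans_le (le_sSup ⟨z, ⟨?_, hz2⟩, rfl⟩)
      exact hmem.1.trans (EReal.coe_lt_coe_iff.1 hz3.2)
  unfold πStar
  rw [hs, hsup]
  refine max_eq_right (le_trans ?_ hmem.2.le)
  have h1 : (0 : ℝ) ≤ θ := hadd.θlo_pos.le.trans hθ.1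
  exact_mod_cast h1

theorem πStar_of_neg (hadd : M.AdditiveErrors εlo εhi h) {θ : ℝ} (hθ : θ ∈ M.types)
    (hk : M.auditGain θ < 0) : M.πStar θ = 0 := by
  have hs : {π ∈ M.innerIncomes θ | M.c ≤ M.μ θ π * M.φ} = ∅ := by
    ext π
    simp only [mem_ofPred_eq, mem_empty_iff_false, iff_false, not_and]
    intro hπ
    rw [hadd.μ_eq hθ hπ]
    unfold auditGain at hk
    linarith
  unfold πStar
  rw [hs]
  simp

theorem ae_g_inner_or_zero (hadd : M.AdditiveErrors εlo εhi h) {θ : ℝ} (hθ : θ ∈ M.types) :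
    ∀ᵐ π : ℝ, π ∈ M.innerIncomes θ ∨ M.g θ π = 0 := by
  have h1 : ∀ᵐ π : ℝ, (εlo < π - θ ∧ ((π - θ : ℝ) : EReal) < εhi) ∨ h (π - θ) = 0 :=
    (measurePreserving_sub_right volume θ).quasiMeasurePreserving.ae hadd.ae_inner_or_zero
  filter_upwards [h1] with π hπ
  rw [hadd.g_eq θ hθ]
  refine hπ.imp (fun hπ => ?_) id
  simpa using (hadd.mem_innerIncomes_iff hθ).2 hπ

theorem ψ_eq (hadd : M.AdditiveErrors εlo εhi h) {θ : ℝ} (hθ : θ ∈ M.types) :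
    M.ψ θ = θ - M.invHazard θ + max (M.auditGain θ) 0 := by
  unfold ψ expIncome
  have e : (fun π => max (M.μ θ π * M.φ - M.c) 0 * M.g θ π) =ᵐ[volume]
      fun π => max (M.auditGain θ) 0 * M.g θ π := by
    filter_upwards [hadd.ae_g_inner_or_zero hθ] with π hπ
    rcases hπ with hπ | hπ
    · rw [hadd.μ_eq hθ hπ, auditGain]
    · rw [hπ, mul_zero, mul_zero]
  rw [integral_congr_ae e, integral_const_mul, M.g_integral θ hθ, mul_one]

theorem Φ_of_nonneg (hadd : M.AdditiveErrors εlo εhi h) {θ : ℝ} (hθ : θ ∈ M.types)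
    (hk : 0 ≤ M.auditGain θ) : M.Φ θ = M.φ := by
  have hS : MeasurableSet {π : ℝ | 0 < π ∧ (π : EReal) ≤ M.πStar θ} :=
    measurableSet_Ioi.inter (measurable_coe_real_ereal measurableSet_Iic)
  -- Incomes are nonnegative, so the domain of integration carries all the mass of `g = -G₂`.
  have e : ∫ π in {π : ℝ | 0 < π ∧ (π : EReal) ≤ M.πStar θ}, M.G₂ π θ = -1 := by
    rw [← integral_indicator hS, ← M.g_integral θ hθ, ← integral_neg]
    refine integral_congr_ae ?_
    filter_upwards [hadd.ae_G₂_eq hθ, hadd.ae_g_inner_or_zero hθ] with π h1 h2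
    rw [hadd.πStar_of_nonneg hθ hk]
    simp only [indicator, mem_ofPred_eq]
    split_ifs with h3
    · rw [h1, hadd.g_eq θ hθ]
    · rcases h2 with h2 | h2
      · exact absurd ⟨(M.πlo_nonneg θ hθ).trans_lt h2.1, h2.2.le⟩ h3
      · rw [h2, neg_zero]
  rw [Φ, e]
  ring

theorem Φ_of_neg (hadd : M.AdditiveErrors εlo εhi h) {θ : ℝ} (hθ : θ ∈ M.types)
    (hk : M.auditGain θ < 0) : M.Φ θ = 0 := by
  have e : {π : ℝ | 0 < π ∧ (π : EReal) ≤ M.πStar θ} = ∅ := by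
    ext π
    rw [hadd.πStar_of_neg hθ hk]
    simp only [mem_ofPred_eq, mem_empty_iff_false, iff_false, not_and, not_le]
    intro hπ
    exact_mod_cast hπ
  rw [Φ, e]
  simp

end AdditiveErrors

/-! ### The distribution of types and its inverse hazard rate -/

section TypeDistribution

variable (M : AuctionModel)

theorem f_nonneg (θ : ℝ) : 0 ≤ M.f θ := by
  by_cases hθ : θ ∈ Icc M.θlo M.θhi
  · have hcl : closure (Ioo M.θlo M.θhi) = Icc M.θlo M.θhi := closure_Ioo M.θlo_lt_θhi.ne
    exact le_on_closure (f := fun _ => (0 : ℝ)) (fun x hx => (M.f_pos x hx).le) continuousOn_const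
      (hcl ▸ M.f_continuousOn) (hcl ▸ hθ)
  · exact (M.f_eq_zero θ hθ).ge

theorem f_integrable : Integrable M.f := integrable_of_integral_eq_one M.f_integral

theorem F_eq (θ : ℝ) : M.F θ = M.F M.θlo + ∫ z in M.θlo..θ, M.f z := by
  unfold F
  rw [← intervalIntegral.integral_Iic_sub_Iic M.f_integrable.integrableOn
    M.f_integrable.integrableOn]
  ring

theorem F_θhi : M.F M.θhi = 1 := by
  unfold F
  rw [← M.f_integral]
  exact setIntegral_eq_integral_of_forall_compl_eq_zero fun z hz =>
    M.f_eq_zero z fun h => hz h.2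

theorem F_continuous : Continuous M.F := by
  have e : M.F = fun θ => M.F M.θlo + ∫ z in M.θlo..θ, M.f z := funext M.F_eq
  rw [e]
  exact continuous_const.add
    (intervalIntegral.continuous_primitive (fun _ _ => M.f_integrable.intervalIntegrable) _)

theorem F_hasDerivAt {θ : ℝ} (hθ : θ ∈ Ioo M.θlo M.θhi) : HasDerivAt M.F (M.f θ) θ := by
  have e : M.F = fun θ => M.F M.θlo + ∫ z in M.θlo..θ, M.f z := funext M.F_eq
  rw [e]
  exact (intervalIntegral.integral_hasDerivAt_right M.f_integrable.intervalIntegrable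
    (M.f_integrable.aestronglyMeasurable.stronglyMeasurableAtFilter)
    (M.f_continuousOn.continuousAt (Icc_mem_nhds hθ.1 hθ.2))).const_add _

theorem one_sub_F_eq (θ : ℝ) : 1 - M.F θ = ∫ z in θ..M.θhi, M.f z := by
  rw [← M.F_θhi]
  exact intervalIntegral.integral_Iic_sub_Iic M.f_integrable.integrableOn
    M.f_integrable.integrableOn

theorem F_lt_one {θ : ℝ} (h1 : M.θlo ≤ θ) (h2 : θ < M.θhi) : M.F θ < 1 := by
  have h3 : 0 < ∫ z in θ..M.θhi, M.f z :=
    intervalIntegral.intervalIntegral_pos_of_pos_on M.f_integrable.intervalIntegrable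
      (fun x hx => M.f_pos x ⟨h1.trans_lt hx.1, hx.2⟩) h2
  linarith [M.one_sub_F_eq θ]

theorem F_le_one {θ : ℝ} (h1 : θ ∈ M.types) : M.F θ ≤ 1 := by
  rcases h1.2.eq_or_lt with h | h
  · rw [h, M.F_θhi]
  · exact (M.F_lt_one h1.1 h).le

theorem invHazard_θhi : M.invHazard M.θhi = 0 := by
  rw [invHazard, M.F_θhi, sub_self, zero_div]

theorem auditGain_θhi : M.auditGain M.θhi = -M.c := by
  rw [auditGain, invHazard_θhi]
  ring

theorem invHazard_nonneg {θ : ℝ} (hθ : θ ∈ M.types) : 0 ≤ M.invHazard θ :=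
  div_nonneg (sub_nonneg.2 (M.F_le_one hθ)) (M.f_nonneg θ)

theorem invHazard_continuousWithinAt {θ : ℝ} (hθ : θ ∈ M.types) (hf : M.f θ ≠ 0) :
    ContinuousWithinAt M.invHazard M.types θ :=
  (continuous_const.sub M.F_continuous).continuousWithinAt.div (M.f_continuousOn θ hθ) hf

theorem auditGain_continuousWithinAt {θ : ℝ} (hθ : θ ∈ M.types) (hf : M.f θ ≠ 0) :
    ContinuousWithinAt M.auditGain M.types θ :=
  ((M.invHazard_continuousWithinAt hθ hf).mul_const _).sub_const _

/-- If `(1 - F) / f ≥ δ` throughout, then `(1 - F) exp(θ / δ)` has a nonnegative derivative; but it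
is positive in the middle of `Θ` and vanishes at the top. This replaces a limit of the hazard rate
at the top, where `f` may vanish. -/
theorem exists_invHazard_lt {δ : ℝ} (hδ : 0 < δ) :
    ∃ θ ∈ Ioo M.θlo M.θhi, M.invHazard θ < δ := by
  by_contra! hcon
  set m := (M.θlo + M.θhi) / 2 with hm
  have hlt := M.θlo_lt_θhi
  have hm1 : M.θlo < m := by linarith
  have hm2 : m < M.θhi := by linarith
  have hd : ∀ θ ∈ Ioo m M.θhi, HasDerivAt (fun x => (1 - M.F x) * Real.exp (x / δ))
      (-M.f θ * Real.exp (θ / δ) + (1 - M.F θ) * (Real.exp (θ / δ) * (1 / δ))) θ := by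
    intro θ hθ
    exact ((M.F_hasDerivAt ⟨hm1.trans hθ.1, hθ.2⟩).const_sub 1).mul
      (((hasDerivAt_id θ).div_const δ).exp)
  have hmono : MonotoneOn (fun x => (1 - M.F x) * Real.exp (x / δ)) (Icc m M.θhi) := by
    refine monotoneOn_of_deriv_nonneg (convex_Icc _ _) ?_ ?_ ?_
    · exact ((continuous_const.sub M.F_continuous).mul (by fun_prop)).continuousOn
    · rw [interior_Icc]
      exact fun θ hθ => (hd θ hθ).differentiableAt.differentiableWithinAt
    · rw [interior_Icc]
      intro θ hθ
      rw [(hd θ hθ).deriv]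
      have hθ' : θ ∈ Ioo M.θlo M.θhi := ⟨hm1.trans hθ.1, hθ.2⟩
      have h1 := hcon θ hθ'
      rw [invHazard, le_div_iff₀ (M.f_pos θ hθ')] at h1
      have h2 : M.f θ ≤ (1 - M.F θ) * (1 / δ) := by
        rw [mul_one_div, le_div_iff₀ hδ]
        linarith
      have h3 := mul_le_mul_of_nonneg_right h2 (Real.exp_pos (θ / δ)).le
      linarith
  have h1 := hmono (left_mem_Icc.2 hm2.le) (right_mem_Icc.2 hm2.le) hm2.le
  simp only [M.F_θhi, sub_self, zero_mul] at h1
  have h2 := M.F_lt_one hm1.le hm2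
  exact absurd h1 (not_le.2 (mul_pos (by linarith) (Real.exp_pos _)))

end TypeDistribution

/-! ### Cutoff types -/

section Cutoffs

variable {M : AuctionModel} {εlo : ℝ} {εhi : EReal} {h : ℝ → ℝ}

/-- Single crossing in the type compares two types only at an income interior to both supports, and
the supports of distant types may be disjoint. Repeated halving of the interval of types produces a
chain of neighbours with overlapping supports. -/
theorem Regular.auditGain_crossing (hreg : M.Regular) (hadd : M.AdditiveErrors εlo εhi h)
    {θ₁ θ₂ : ℝ} (h₁ : θ₁ ∈ Ioo M.θlo M.θhi) (h₂ : θ₂ ∈ Ioo M.θlo M.θhi) (hlt : θ₁ ≤ θ₂)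
    (hk : 0 ≤ M.auditGain θ₂) : 0 ≤ M.auditGain θ₁ := by
  have key : ∀ n : ℕ, ∀ θ₁ ∈ Ioo M.θlo M.θhi, ∀ θ₂ ∈ Ioo M.θlo M.θhi, θ₁ ≤ θ₂ →
      θ₂ - θ₁ < 2 ^ n * -εlo → 0 ≤ M.auditGain θ₂ → 0 ≤ M.auditGain θ₁ := by
    intro n
    induction n with
    | zero =>
      intro θ₁ h₁ θ₂ h₂ hle hgap hk
      rcases hle.eq_or_lt with rfl | hlt
      · exact hk
      have h₁' : θ₁ ∈ M.types := Ioo_subset_Icc_self h₁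
      have h₂' : θ₂ ∈ M.types := Ioo_subset_Icc_self h₂
      have hm₁ := hadd.self_mem_innerIncomes h₁'
      -- The gap is below `-εlo`, so the mean income of the lower type lies above the bottom of the
      -- support of the higher one.
      have hm₂ : θ₁ ∈ M.innerIncomes θ₂ := by
        refine ⟨?_, ?_⟩
        · rw [hadd.πlo_eq θ₂ h₂']
          linarith
        · exact (EReal.coe_lt_coe_iff.2 hlt).trans (hadd.self_mem_innerIncomes h₂').2
      by_contra hneg
      have h3 := (hreg.crossing_type θ₁ h₁ θ₂ h₂ hlt θ₁ ⟨hm₁, hm₂⟩).2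
      rw [hadd.μ_eq h₁' hm₁, hadd.μ_eq h₂' hm₂] at h3
      exact absurd (h3 (not_le.1 hneg)) (not_lt.2 hk)
    | succ n ih =>
      intro θ₁ h₁ θ₂ h₂ hle hgap hk
      have hm : (θ₁ + θ₂) / 2 ∈ Ioo M.θlo M.θhi :=
        ⟨by linarith [h₁.1, h₂.1], by linarith [h₁.2, h₂.2]⟩
      rw [pow_succ] at hgap
      exact ih θ₁ h₁ _ hm (by linarith) (by linarith)
        (ih _ hm θ₂ h₂ (by linarith) (by linarith) hk)
  have hε : 0 < -εlo := neg_pos.2 hadd.εlo_neg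
  obtain ⟨n, hn⟩ := pow_unbounded_of_one_lt ((θ₂ - θ₁) / -εlo) one_lt_two
  exact key n θ₁ h₁ θ₂ h₂ hlt ((div_lt_iff₀ hε).1 hn) hk

theorem auditGain_nonneg_of_c_eq_zero (hc : M.c = 0) {θ : ℝ} (hθ : θ ∈ M.types) :
    0 ≤ M.auditGain θ := by
  rw [auditGain, hc, sub_zero]
  exact mul_nonneg (M.invHazard_nonneg hθ) M.φ_mem.1

theorem bddAbove_auditGain :
    BddAbove (insert M.θlo {θ ∈ Ioo M.θlo M.θhi | 0 ≤ M.invHazard θ * M.φ - M.c}) := by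
  refine ⟨M.θhi, ?_⟩
  rintro x (rfl | hx)
  · exact M.θlo_lt_θhi.le
  · exact hx.1.2.le

theorem le_θStar {θ : ℝ} (hθ : θ ∈ Ioo M.θlo M.θhi) (hk : 0 ≤ M.auditGain θ) : θ ≤ M.θStar :=
  le_csSup bddAbove_auditGain (Or.inr ⟨hθ, hk⟩)

theorem Regular.auditGain_nonneg_of_lt_θStar (hreg : M.Regular)
    (hadd : M.AdditiveErrors εlo εhi h) {θ : ℝ} (hθ : M.θlo < θ) (hlt : θ < M.θStar) :
    0 ≤ M.auditGain θ := by
  obtain ⟨x, hx, hx'⟩ := exists_lt_of_lt_csSup (insert_nonempty _ _) hlt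
  rcases hx with rfl | hx
  · exact absurd hθ hx'.not_gt
  · exact hreg.auditGain_crossing hadd ⟨hθ, hx'.trans hx.1.2⟩ hx.1 hx'.le hx.2

/-- Crossing makes the audited types an initial segment, and left continuity includes its endpoint.
At the top type the gain is `-c`: if `c = 0`, all types are audited and `θ*` is the top; if `c > 0`,
a small inverse hazard rate somewhere in the interior keeps `θ*` below it. The lowest type is
excluded because the hazard rate is not meaningful there if `f` vanishes. -/
theorem Regular.auditGain_nonneg_iff (hreg : M.Regular) (hadd : M.AdditiveErrors εlo εhi h)
    {θ : ℝ} (hθ : θ ∈ M.types) (hne : θ ≠ M.θlo) : 0 ≤ M.auditGain θ ↔ θ ≤ M.θStar := by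
  have hlo : M.θlo < θ := lt_of_le_of_ne hθ.1 hne.symm
  rcases hθ.2.eq_or_lt with rfl | hhi
  · rcases M.c_nonneg.eq_or_lt with hc | hc
    · refine iff_of_true (auditGain_nonneg_of_c_eq_zero hc.symm hθ) (le_of_forall_lt fun x hx => ?_)
      obtain ⟨y, hy1, hy2⟩ := exists_between (max_lt hx hlo)
      have hy : y ∈ Ioo M.θlo M.θhi := ⟨(le_max_right _ _).trans_lt hy1, hy2⟩
      exact ((le_max_left _ _).trans_lt hy1).trans_le
        (le_θStar hy (auditGain_nonneg_of_c_eq_zero hc.symm (Ioo_subset_Icc_self hy)))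
    · refine iff_of_false ?_ ?_
      · rw [auditGain_θhi]
        linarith
      · obtain ⟨y, hy, hy'⟩ := M.exists_invHazard_lt hc
        have hk : M.auditGain y < 0 := by
          have h1 := mul_le_of_le_one_right (M.invHazard_nonneg (Ioo_subset_Icc_self hy)) M.φ_mem.2
          unfold auditGain
          linarith
        intro hle
        exact absurd (hreg.auditGain_nonneg_of_lt_θStar hadd hy.1 (hy.2.trans_le hle))
          (not_le.2 hk)
  · refine ⟨fun hk => le_θStar ⟨hlo, hhi⟩ hk, fun hle => ?_⟩
    rcases hle.eq_or_lt with heq | hlt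
    · have hc := M.auditGain_continuousWithinAt hθ (M.f_pos θ ⟨hlo, hhi⟩).ne'
      have hc' : ContinuousWithinAt M.auditGain (Ioo M.θlo θ) θ :=
        hc.mono fun x hx => ⟨hx.1.le, hx.2.le.trans hθ.2⟩
      have hcl : θ ∈ closure (Ioo M.θlo θ) := by
        rw [closure_Ioo hlo.ne]
        exact right_mem_Icc.2 hlo.le
      have : (nhdsWithin θ (Ioo M.θlo θ)).NeBot := mem_closure_iff_nhdsWithin_neBot.1 hcl
      refine ge_of_tendsto hc' ?_
      filter_upwards [self_mem_nhdsWithin] with x hx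
      exact hreg.auditGain_nonneg_of_lt_θStar hadd hx.1 (heq ▸ hx.2)
    · exact hreg.auditGain_nonneg_of_lt_θStar hadd hlo hlt

theorem θZero_eq (hadd : M.AdditiveErrors εlo εhi h) :
    M.θZero = sInf {θ ∈ Ioo M.θlo M.θhi | 0 < M.ψ θ} := by
  unfold θZero
  congr 1
  ext θ
  refine and_congr_right fun hθ => ?_
  rw [hadd.ψ_eq (Ioo_subset_Icc_self hθ), auditGain]

/-- All types are positive, so it suffices that the inverse hazard rate falls below `θlo` somewhere.
Hence the infimum that defines `θZero` is over a nonempty set. -/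
theorem exists_ψ_pos (hadd : M.AdditiveErrors εlo εhi h) : ∃ θ ∈ Ioo M.θlo M.θhi, 0 < M.ψ θ := by
  obtain ⟨θ, hθ, hlt⟩ := M.exists_invHazard_lt hadd.θlo_pos
  refine ⟨θ, hθ, ?_⟩
  rw [hadd.ψ_eq (Ioo_subset_Icc_self hθ)]
  have := le_max_right (M.auditGain θ) 0
  linarith [hθ.1]

theorem bddBelow_ψ_pos : BddBelow {θ ∈ Ioo M.θlo M.θhi | 0 < M.ψ θ} :=
  ⟨M.θlo, fun _ hx => hx.1.1.le⟩

theorem θlo_le_θZero (hadd : M.AdditiveErrors εlo εhi h) : M.θlo ≤ M.θZero := by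
  rw [θZero_eq hadd]
  exact le_csInf (exists_ψ_pos hadd) fun x hx => hx.1.1.le

theorem θZero_lt_θhi (hadd : M.AdditiveErrors εlo εhi h) : M.θZero < M.θhi := by
  rw [θZero_eq hadd]
  obtain ⟨θ, hθ, hpos⟩ := exists_ψ_pos hadd
  exact (csInf_le bddBelow_ψ_pos ⟨hθ, hpos⟩).trans_lt hθ.2

theorem ψ_continuousWithinAt (hadd : M.AdditiveErrors εlo εhi h) {θ : ℝ} (hθ : θ ∈ M.types)
    (hf : M.f θ ≠ 0) : ContinuousWithinAt M.ψ M.types θ := by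
  refine ContinuousWithinAt.congr (f := fun θ => θ - M.invHazard θ + max (M.auditGain θ) 0)
    ?_ (fun y hy => hadd.ψ_eq hy) (hadd.ψ_eq hθ)
  exact (continuousWithinAt_id.sub (M.invHazard_continuousWithinAt hθ hf)).add
    ((M.auditGain_continuousWithinAt hθ hf).max continuousWithinAt_const)

theorem ψ_θhi (hadd : M.AdditiveErrors εlo εhi h) : M.ψ M.θhi = M.θhi := by
  rw [hadd.ψ_eq (right_mem_Icc.2 M.θlo_lt_θhi.le), auditGain_θhi, invHazard_θhi,
    max_eq_right (by linarith [M.c_nonneg])]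
  ring

/-- Left continuity of `ψ` makes the inequality `θZero < θ` strict: a positive value persists at
slightly lower types. The converse is monotonicity. -/
theorem Regular.ψ_pos_iff (hreg : M.Regular) (hadd : M.AdditiveErrors εlo εhi h)
    {θ : ℝ} (hθ : θ ∈ M.types) (hne : θ ≠ M.θlo) : 0 < M.ψ θ ↔ M.θZero < θ := by
  have hlo : M.θlo < θ := lt_of_le_of_ne hθ.1 hne.symm
  rcases hθ.2.eq_or_lt with rfl | hhi
  · rw [ψ_θhi hadd]
    exact iff_of_true (hadd.θlo_pos.trans hlo) (θZero_lt_θhi hadd)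
  constructor
  · intro hpos
    have hc := ψ_continuousWithinAt hadd hθ (M.f_pos θ ⟨hlo, hhi⟩).ne'
    have hc' : ContinuousWithinAt M.ψ (Ioo M.θlo θ) θ :=
      hc.mono fun x hx => ⟨hx.1.le, hx.2.le.trans hθ.2⟩
    have hcl : θ ∈ closure (Ioo M.θlo θ) := by
      rw [closure_Ioo hlo.ne]
      exact right_mem_Icc.2 hlo.le
    have : (nhdsWithin θ (Ioo M.θlo θ)).NeBot := mem_closure_iff_nhdsWithin_neBot.1 hcl
    obtain ⟨x, hx, hx'⟩ := ((hc'.eventually_const_lt hpos).and self_mem_nhdsWithin).exists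
    rw [θZero_eq hadd]
    exact (csInf_le bddBelow_ψ_pos ⟨⟨hx'.1, hx'.2.trans hhi⟩, hx⟩).trans_lt hx'.2
  · intro hlt
    rw [θZero_eq hadd] at hlt
    obtain ⟨x, hx, hx'⟩ := exists_lt_of_csInf_lt (exists_ψ_pos hadd) hlt
    exact hx.2.trans (hreg.ψ_strictMono hx.1 ⟨hlo, hhi⟩ hx')

/-- The lowest type is a limit of types in the interior. -/
theorem neBot_θlo : (nhdsWithin M.θlo (Ioo M.θlo M.θhi)).NeBot := by
  refine mem_closure_iff_nhdsWithin_neBot.1 ?_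
  rw [closure_Ioo M.θlo_lt_θhi.ne]
  exact left_mem_Icc.2 M.θlo_lt_θhi.le

theorem Regular.θZero_eq_θlo (hreg : M.Regular) (hadd : M.AdditiveErrors εlo εhi h)
    (hf : M.f M.θlo ≠ 0) (hψ : 0 < M.ψ M.θlo) : M.θZero = M.θlo := by
  refine le_antisymm (le_of_forall_gt fun y hy => ?_) (θlo_le_θZero hadd)
  have hc := (ψ_continuousWithinAt hadd (left_mem_Icc.2 M.θlo_lt_θhi.le) hf).mono
    (Ioo_subset_Icc_self)
  have := neBot_θlo (M := M)
  obtain ⟨x, ⟨hx, hx'⟩, hx''⟩ := ((hc.eventually_const_lt hψ).and self_mem_nhdsWithin |>.and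
    (mem_nhdsWithin_of_mem_nhds (Iio_mem_nhds hy))).exists
  exact ((hreg.ψ_pos_iff hadd (Ioo_subset_Icc_self hx') hx'.1.ne').1 hx).trans hx''

theorem Regular.auditGain_θlo_nonneg (hreg : M.Regular) (hadd : M.AdditiveErrors εlo εhi h)
    (hf : M.f M.θlo ≠ 0) (hlt : M.θlo < M.θStar) : 0 ≤ M.auditGain M.θlo := by
  have hc := (M.auditGain_continuousWithinAt (left_mem_Icc.2 M.θlo_lt_θhi.le) hf).mono
    (Ioo_subset_Icc_self)
  have := neBot_θlo (M := M)
  refine ge_of_tendsto hc ?_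
  filter_upwards [self_mem_nhdsWithin, mem_nhdsWithin_of_mem_nhds (Iio_mem_nhds hlt)] with x hx hx'
  exact hreg.auditGain_nonneg_of_lt_θStar hadd hx.1 hx'

end Cutoffs

/-! ### Reporting income as truthfully as possible -/

section Projection

variable (M : AuctionModel)

theorem proj_of_mem {θ π : ℝ} (hπ : π ∈ M.incomes θ) : M.proj θ π = π := by
  rw [proj, min_eq_left hπ.2, EReal.toReal_coe, max_eq_right hπ.1]

theorem proj_of_lt {θ π : ℝ} (hθ : θ ∈ M.types) (hπ : π < M.πlo θ) :
    M.proj θ π = M.πlo θ := by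
  have h1 : (π : EReal) ≤ M.πhi θ :=
    ((EReal.coe_lt_coe_iff.2 hπ).trans (M.πlo_lt_πhi θ hθ)).le
  rw [proj, min_eq_left h1, EReal.toReal_coe, max_eq_left hπ.le]

theorem πhi_eq_coe {θ π : ℝ} (hθ : θ ∈ M.types) (hπ : M.πhi θ < π) :
    ((M.πhi θ).toReal : EReal) = M.πhi θ :=
  EReal.coe_toReal (hπ.trans (EReal.coe_lt_top π)).ne
    ((EReal.bot_lt_coe _).trans (M.πlo_lt_πhi θ hθ)).ne'

theorem proj_of_gt {θ π : ℝ} (hθ : θ ∈ M.types) (hπ : M.πhi θ < π) :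
    M.proj θ π = (M.πhi θ).toReal := by
  rw [proj, min_eq_right hπ.le, max_eq_right]
  have := M.πlo_lt_πhi θ hθ
  rw [← M.πhi_eq_coe hθ hπ] at this
  exact (EReal.coe_lt_coe_iff.1 this).le

theorem πlo_mem_incomes {θ : ℝ} (hθ : θ ∈ M.types) : M.πlo θ ∈ M.incomes θ :=
  ⟨le_rfl, (M.πlo_lt_πhi θ hθ).le⟩

theorem proj_mem {θ : ℝ} (hθ : θ ∈ M.types) (π : ℝ) : M.proj θ π ∈ M.incomes θ := by
  rcases lt_or_ge π (M.πlo θ) with h1 | h1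
  · rw [M.proj_of_lt hθ h1]
    exact M.πlo_mem_incomes hθ
  rcases lt_or_ge (M.πhi θ) (π : EReal) with h2 | h2
  · have h3 := M.πlo_lt_πhi θ hθ
    rw [M.proj_of_gt hθ h2]
    rw [← M.πhi_eq_coe hθ h2] at h3
    exact ⟨(EReal.coe_lt_coe_iff.1 h3).le, (M.πhi_eq_coe hθ h2).le⟩
  · rw [M.proj_of_mem ⟨h1, h2⟩]
    exact ⟨h1, h2⟩

theorem proj_pos {θ π : ℝ} (hθ : θ ∈ M.types) (hπ : 0 < π) : 0 < M.proj θ π := by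
  have hlo := M.πlo_nonneg θ hθ
  rcases lt_or_ge π (M.πlo θ) with h1 | h1
  · rw [M.proj_of_lt hθ h1]
    exact hπ.trans h1
  rcases lt_or_ge (M.πhi θ) (π : EReal) with h2 | h2
  · have h3 := M.πlo_lt_πhi θ hθ
    rw [M.proj_of_gt hθ h2]
    rw [← M.πhi_eq_coe hθ h2] at h3
    exact hlo.trans_lt (EReal.coe_lt_coe_iff.1 h3)
  · rwa [M.proj_of_mem ⟨h1, h2⟩]

theorem incomes_nonneg {θ π : ℝ} (hθ : θ ∈ M.types) (hπ : π ∈ M.incomes θ) : 0 ≤ π :=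
  (M.πlo_nonneg θ hθ).trans hπ.1

theorem innerIncomes_pos {θ π : ℝ} (hθ : θ ∈ M.types) (hπ : π ∈ M.innerIncomes θ) : 0 < π :=
  (M.πlo_nonneg θ hθ).trans_lt hπ.1

theorem innerIncomes_subset (θ : ℝ) : M.innerIncomes θ ⊆ M.incomes θ :=
  fun _ hπ => ⟨hπ.1.le, hπ.2.le⟩

theorem incomes_subset {θ : ℝ} (hθ : θ ∈ M.types) : M.incomes θ ⊆ M.allIncomes :=
  subset_biUnion_of_mem hθ

end Projection

/-! ### The starred mechanism: linear sharing and feasibility -/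

section Star

variable {M : AuctionModel} {εlo : ℝ} {εhi : EReal} {h : ℝ → ℝ}

theorem qStar_eq_zero_or_one (θ : ℝ) : M.qStar θ = 0 ∨ M.qStar θ = 1 := by
  unfold qStar
  split_ifs <;> simp

theorem qStar_mem (θ : ℝ) : M.qStar θ ∈ Icc (0 : ℝ) 1 := by
  rcases M.qStar_eq_zero_or_one θ with h | h <;> simp [h]

theorem Regular.qStar_eq (hreg : M.Regular) (hadd : M.AdditiveErrors εlo εhi h) {θ : ℝ}
    (hθ : θ ∈ M.types) (hne : θ ≠ M.θlo) : M.qStar θ = if M.θZero < θ then 1 else 0 := by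
  simp only [qStar, hreg.ψ_pos_iff hadd hθ hne, hne, false_and, not_false_eq_true, and_true]

theorem AdditiveErrors.Φ_eq (hadd : M.AdditiveErrors εlo εhi h) {θ : ℝ} (hθ : θ ∈ M.types) :
    M.Φ θ = if 0 ≤ M.auditGain θ then M.φ else 0 := by
  split_ifs with hk
  · exact hadd.Φ_of_nonneg hθ hk
  · exact hadd.Φ_of_neg hθ (not_le.1 hk)

theorem Regular.Φ_eq (hreg : M.Regular) (hadd : M.AdditiveErrors εlo εhi h) {θ : ℝ}
    (hθ : θ ∈ M.types) (hne : θ ≠ M.θlo) : M.Φ θ = if θ ≤ M.θStar then M.φ else 0 := by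
  simp only [hadd.Φ_eq hθ, hreg.auditGain_nonneg_iff hadd hθ hne]

theorem AdditiveErrors.rStar_eq (hadd : M.AdditiveErrors εlo εhi h) {θ : ℝ} (hθ : θ ∈ M.types)
    {π : ℝ} (hπ : π ∈ M.incomes θ) : M.rStar θ π = M.Φ θ * π := by
  rcases le_or_gt 0 (M.auditGain θ) with hk | hk
  · rw [rStar, hadd.πStar_of_nonneg hθ hk, hadd.Φ_of_nonneg hθ hk, min_eq_left hπ.2,
      EReal.toReal_coe, mul_comm]
  · have h0 : (0 : EReal) ≤ π := by exact_mod_cast M.incomes_nonneg hθ hπ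
    rw [rStar, hadd.πStar_of_neg hθ hk, hadd.Φ_of_neg hθ hk, min_eq_right h0]
    simp

theorem AdditiveErrors.aStar_of_nonneg (hadd : M.AdditiveErrors εlo εhi h) {θ : ℝ}
    (hθ : θ ∈ M.types) (hk : 0 ≤ M.auditGain θ) {π : ℝ} (hπ : π ∈ M.incomes θ) :
    M.aStar θ π = 1 := by
  rw [aStar, hadd.πStar_of_nonneg hθ hk, if_pos hπ.2]

/-- With `π* = 0` the tie convention still audits a report of zero. -/
theorem AdditiveErrors.aStar_of_neg (hadd : M.AdditiveErrors εlo εhi h) {θ : ℝ}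
    (hθ : θ ∈ M.types) (hk : M.auditGain θ < 0) (π : ℝ) :
    M.aStar θ π = if π ≤ 0 then 1 else 0 := by
  rw [aStar, hadd.πStar_of_neg hθ hk]
  norm_cast

/-- The royalties and penalties paid by an agent who reports his income as truthfully as possible
are linear in his income. -/
theorem AdditiveErrors.u_star (hadd : M.AdditiveErrors εlo εhi h) {θ : ℝ} (hθ : θ ∈ M.types)
    {π : ℝ} (hπ : 0 < π) :
    u M.star θ (M.proj θ π) π = M.qStar θ * (1 - M.Φ θ) * π := by
  have hmem := M.proj_mem hθ π
  simp only [u, star, hadd.rStar_eq hθ hmem, pStar]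
  rcases le_or_gt 0 (M.auditGain θ) with hk | hk
  · rw [hadd.aStar_of_nonneg hθ hk hmem, hadd.Φ_of_nonneg hθ hk]
    ring
  · rw [hadd.aStar_of_neg hθ hk, hadd.Φ_of_neg hθ hk, if_neg (not_le.2 (M.proj_pos hθ hπ))]
    ring

/-- A fixed share of income is kept and the mean income of a type is the type itself; so the utility
from a given type report is linear in the true type. -/
theorem AdditiveErrors.U_star (hadd : M.AdditiveErrors εlo εhi h) {θ' θ : ℝ}
    (hθ' : θ' ∈ M.types) (hθ : θ ∈ M.types) :
    M.U M.star θ' θ = M.qStar θ' * (1 - M.Φ θ') * θ := by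
  have e : (fun π => u M.star θ' (M.proj θ' π) π * M.g θ π) =ᵐ[volume]
      fun π => M.qStar θ' * (1 - M.Φ θ') * (π * M.g θ π) := by
    filter_upwards [hadd.ae_g_inner_or_zero hθ] with π hπ
    rcases hπ with hπ | hπ
    · rw [hadd.u_star hθ' (M.innerIncomes_pos hθ hπ)]
      ring
    · simp [hπ]
  rw [U, expIncome, integral_congr_ae e, integral_const_mul, M.income_mean θ hθ]

theorem AdditiveErrors.tStar_eq (hadd : M.AdditiveErrors εlo εhi h) {θ : ℝ}
    (hθ : θ ∈ M.types) : M.tStar θ = M.qStar θ * (1 - M.Φ θ) * θ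
      - ∫ z in M.θlo..θ, M.qStar z * (1 - M.Φ z) := by
  have e : (fun π => (π - M.rStar θ π) * M.g θ π) =ᵐ[volume]
      fun π => (1 - M.Φ θ) * (π * M.g θ π) := by
    filter_upwards [hadd.ae_g_inner_or_zero hθ] with π hπ
    rcases hπ with hπ | hπ
    · rw [hadd.rStar_eq hθ (M.innerIncomes_subset θ hπ)]
      ring
    · simp [hπ]
  rw [tStar, expIncome, integral_congr_ae e, integral_const_mul, M.income_mean θ hθ]
  ring

/-- The marginal utility of a type in the mechanism `(q*, t*, r*, a*, p*)`, away from the lowest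
type: the share of the income that he keeps. -/
noncomputable def netShare (M : AuctionModel) (z : ℝ) : ℝ :=
  if z ≤ M.θZero then 0 else if z ≤ M.θStar then 1 - M.φ else 1

theorem netShare_monotone : Monotone M.netShare := by
  intro x y hxy
  have h1 := M.φ_mem.1
  have h2 := M.φ_mem.2
  unfold netShare
  split_ifs <;> linarith

theorem Regular.netShare_eq (hreg : M.Regular) (hadd : M.AdditiveErrors εlo εhi h) {θ : ℝ}
    (hθ : θ ∈ M.types) (hne : θ ≠ M.θlo) : M.qStar θ * (1 - M.Φ θ) = M.netShare θ := by
  rw [hreg.qStar_eq hadd hθ hne, hreg.Φ_eq hadd hθ hne, netShare]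
  by_cases h1 : M.θZero < θ
  · rw [if_pos h1, if_neg (not_le.2 h1)]
    split_ifs <;> ring
  · rw [if_neg h1, if_pos (not_lt.1 h1), zero_mul]

theorem Regular.integral_netShare (hreg : M.Regular) (hadd : M.AdditiveErrors εlo εhi h) {θ : ℝ}
    (hθ : θ ∈ M.types) :
    ∫ z in M.θlo..θ, M.qStar z * (1 - M.Φ z) = ∫ z in M.θlo..θ, M.netShare z := by
  rw [intervalIntegral.integral_of_le hθ.1, intervalIntegral.integral_of_le hθ.1]
  refine setIntegral_congr_fun measurableSet_Ioc fun z hz => ?_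
  exact hreg.netShare_eq hadd ⟨hz.1.le, hz.2.trans hθ.2⟩ hz.1.ne'

theorem netShare_intervalIntegrable (a b : ℝ) : IntervalIntegrable M.netShare volume a b :=
  netShare_monotone.intervalIntegrable

theorem AdditiveErrors.Φ_nonneg (hadd : M.AdditiveErrors εlo εhi h) {θ : ℝ} (hθ : θ ∈ M.types) :
    0 ≤ M.Φ θ := by
  rw [hadd.Φ_eq hθ]
  split_ifs
  exacts [M.φ_mem.1, le_rfl]

/-- The lowest type keeps no larger share of the income than the types above him. -/
theorem Regular.qStar_θlo_le (hreg : M.Regular) (hadd : M.AdditiveErrors εlo εhi h) {z : ℝ}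
    (hz : M.θlo < z) : M.qStar M.θlo * (1 - M.Φ M.θlo) ≤ M.netShare z := by
  have hlo : M.θlo ∈ M.types := left_mem_Icc.2 M.θlo_lt_θhi.le
  by_cases hq : 0 < M.ψ M.θlo ∧ ¬ (M.θlo = M.θlo ∧ M.f M.θlo = 0)
  · have hf : M.f M.θlo ≠ 0 := fun hf => hq.2 ⟨rfl, hf⟩
    have hq1 : M.qStar M.θlo = 1 := if_pos hq
    have hZ := hreg.θZero_eq_θlo hadd hf hq.1
    rw [hq1, one_mul, netShare, hZ, if_neg (not_le.2 hz)]
    split_ifs with h1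
    · rw [hadd.Φ_of_nonneg hlo (hreg.auditGain_θlo_nonneg hadd hf (hz.trans_le h1))]
    · linarith [hadd.Φ_nonneg hlo]
  · have hq0 : M.qStar M.θlo = 0 := if_neg hq
    have h1 := M.φ_mem.2
    rw [hq0, zero_mul, netShare]
    split_ifs <;> linarith

/-- The subgradient inequality for the equilibrium utility of the agent. -/
theorem Regular.subgradient (hreg : M.Regular) (hadd : M.AdditiveErrors εlo εhi h) {θ' θ : ℝ}
    (hθ' : θ' ∈ M.types) (hθ : θ ∈ M.types) :
    M.qStar θ' * (1 - M.Φ θ') * (θ - θ') ≤ ∫ z in θ'..θ, M.netShare z := by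
  have hlow : ∀ z, θ' < z → M.qStar θ' * (1 - M.Φ θ') ≤ M.netShare z := by
    intro z hz
    rcases eq_or_ne θ' M.θlo with rfl | hne
    · exact hreg.qStar_θlo_le hadd hz
    · rw [hreg.netShare_eq hadd hθ' hne]
      exact netShare_monotone hz.le
  rcases le_total θ' θ with hle | hle
  · have h1 := intervalIntegral.integral_mono_on_of_le_Ioo hle
      (intervalIntegrable_const (c := M.qStar θ' * (1 - M.Φ θ')))
      (netShare_intervalIntegrable θ' θ) fun z hz => hlow z hz.1
    rw [intervalIntegral.integral_const, smul_eq_mul] at h1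
    linarith
  · rcases hle.eq_or_lt with rfl | hlt
    · simp
    -- A downward deviation target exists below `θ'`, so the share of `θ'` is exactly `netShare`;
    -- the one-sided bound at the lowest type is needed only upwards.
    have hne : θ' ≠ M.θlo := (hθ.1.trans_lt hlt).ne'
    have h1 := intervalIntegral.integral_mono_on_of_le_Ioo hle
      (netShare_intervalIntegrable θ θ')
      (intervalIntegrable_const (c := M.netShare θ')) fun z hz => netShare_monotone hz.2.le
    rw [intervalIntegral.integral_const, smul_eq_mul] at h1
    rw [hreg.netShare_eq hadd hθ' hne, intervalIntegral.integral_symm]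
    linarith

theorem measurable_domRestrict_of_eqOn {α : Type*} [MeasurableSpace α] {s : Set α} {d m : α → ℝ}
    (hm : Measurable m) (heq : EqOn d m s) : Measurable (s.domRestrict d) := by
  have : s.domRestrict d = fun x : s => m x := by
    ext x
    exact heq x.2
  rw [this]
  exact hm.comp measurable_subtype_coe

/-- By crossing, the audited types form an initial segment, except that the lowest type has to be
treated separately. -/
theorem Regular.exists_measurable_audit (hreg : M.Regular) (hadd : M.AdditiveErrors εlo εhi h) :
    ∃ S : Set ℝ, MeasurableSet S ∧ ∀ θ ∈ M.types, 0 ≤ M.auditGain θ ↔ θ ∈ S := by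
  by_cases hk : 0 ≤ M.auditGain M.θlo
  · refine ⟨Iic M.θStar ∪ {M.θlo}, measurableSet_Iic.union (measurableSet_singleton _),
      fun θ hθ => ?_⟩
    rcases eq_or_ne θ M.θlo with rfl | hne
    · exact iff_of_true hk (Or.inr rfl)
    · rw [hreg.auditGain_nonneg_iff hadd hθ hne]
      exact ⟨Or.inl, fun hx => hx.resolve_right hne⟩
  · refine ⟨Iic M.θStar \ {M.θlo}, measurableSet_Iic.diff (measurableSet_singleton _),
      fun θ hθ => ?_⟩
    rcases eq_or_ne θ M.θlo with rfl | hne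
    · exact iff_of_false hk fun hx => hx.2 rfl
    · rw [hreg.auditGain_nonneg_iff hadd hθ hne]
      exact ⟨fun hx => ⟨hx, hne⟩, fun hx => hx.1⟩

theorem Regular.exists_measurable_qStar (hreg : M.Regular) (hadd : M.AdditiveErrors εlo εhi h) :
    ∃ q : ℝ → ℝ, Measurable q ∧ EqOn M.qStar q M.types := by
  refine ⟨fun θ => if θ = M.θlo then M.qStar M.θlo else if M.θZero < θ then 1 else 0,
    Measurable.ite (measurableSet_singleton _) measurable_const
      (Measurable.ite measurableSet_Ioi measurable_const measurable_const), fun θ hθ => ?_⟩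
  dsimp only
  split_ifs with h1 h2
  · rw [h1]
  · rw [hreg.qStar_eq hadd hθ h1, if_pos h2]
  · rw [hreg.qStar_eq hadd hθ h1, if_neg h2]

theorem Regular.star_isFeasible (hreg : M.Regular) (hadd : M.AdditiveErrors εlo εhi h) :
    M.IsFeasible M.star := by
  obtain ⟨q, hq, hq'⟩ := hreg.exists_measurable_qStar hadd
  obtain ⟨S, hS, hS'⟩ := hreg.exists_measurable_audit hadd
  classical
  have hΦ : Measurable fun θ => if θ ∈ S then M.φ else 0 :=
    Measurable.ite hS measurable_const measurable_const
  have hΦ' : EqOn M.Φ (fun θ => if θ ∈ S then M.φ else 0) M.types := fun θ hθ => by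
    simp only [hadd.Φ_eq hθ, hS' θ hθ]
  -- The payoff from imitating `θ'` is the line through the rent of `θ'` whose slope is his share;
  -- so truthful type reports amount to the subgradient inequality.
  have hval : ∀ θ' ∈ M.types, ∀ θ ∈ M.types, M.U M.star θ' θ - M.star.t θ' =
      (∫ z in M.θlo..θ', M.netShare z) + M.qStar θ' * (1 - M.Φ θ') * (θ - θ') := by
    intro θ' hθ' θ hθ
    change _ - M.tStar θ' = _
    rw [hadd.U_star hθ' hθ, hadd.tStar_eq hθ', hreg.integral_netShare hadd hθ']
    ring
  refine
    { q_mem := fun θ _ => qStar_mem θ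
      a_mem := ?_
      q_measurable := measurable_domRestrict_of_eqOn hq hq'
      t_measurable := ?_
      r_measurable := ?_
      a_measurable := ?_
      p_measurable := ?_
      double_monotone := ?_
      ic_income := ?_
      ic_type := ?_
      ir := ?_ }
  · intro θ _ π _
    change M.aStar θ π ∈ _
    unfold aStar
    split_ifs <;> simp
  · refine measurable_domRestrict_of_eqOn
      (m := fun θ => q θ * (1 - if θ ∈ S then M.φ else 0) * θ - ∫ z in M.θlo..θ, M.netShare z)
      (((hq.mul (measurable_const.sub hΦ)).mul measurable_id).sub
        (intervalIntegral.continuous_primitive netShare_intervalIntegrable _).measurable)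
      fun θ hθ => ?_
    change M.tStar θ = _
    rw [hadd.tStar_eq hθ, hreg.integral_netShare hadd hθ, hq' hθ, hΦ' hθ]
  · refine measurable_domRestrict_of_eqOn
      (m := fun x : ℝ × ℝ => (if x.1 ∈ S then M.φ else 0) * x.2)
      ((hΦ.comp measurable_fst).mul measurable_snd) fun x hx => ?_
    change M.rStar x.1 x.2 = _
    rw [hadd.rStar_eq hx.1 hx.2, hΦ' hx.1]
  · refine measurable_domRestrict_of_eqOn
      (m := fun x : ℝ × ℝ => if x.1 ∈ S then 1 else if x.2 ≤ 0 then 1 else 0)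
      (Measurable.ite (measurable_fst hS) measurable_const
        (Measurable.ite (measurable_snd measurableSet_Iic) measurable_const measurable_const))
      fun x hx => ?_
    change M.aStar x.1 x.2 = if x.1 ∈ S then 1 else if x.2 ≤ 0 then 1 else 0
    split_ifs with h1 h2
    · exact hadd.aStar_of_nonneg hx.1 ((hS' _ hx.1).2 h1) hx.2
    · rw [hadd.aStar_of_neg hx.1 (not_le.1 fun hk => h1 ((hS' _ hx.1).1 hk)), if_pos h2]
    · rw [hadd.aStar_of_neg hx.1 (not_le.1 fun hk => h1 ((hS' _ hx.1).1 hk)), if_neg h2]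
  · refine measurable_domRestrict_of_eqOn
      (m := fun x : ℝ × ℝ × ℝ => (x.2.2 - x.2.1) * M.φ) (by fun_prop) fun x _ => rfl
  · intro θ _ π' _ π₁ _ π₂ _ hlt
    change 0 ≤ (π₂ - π') * M.φ - (π₁ - π') * M.φ ∧
      (π₂ - π') * M.φ - (π₁ - π') * M.φ ≤ (π₂ - π₁) * M.φ
    have h1 := mul_nonneg (sub_nonneg.2 hlt.le) M.φ_mem.1
    constructor <;> linarith
  · intro θ hθ π hπ π' hπ'
    simp only [u, star, pStar, hadd.rStar_eq hθ hπ, hadd.rStar_eq hθ hπ']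
    refine mul_le_mul_of_nonneg_left ?_ (qStar_mem θ).1
    rcases le_or_gt 0 (M.auditGain θ) with hk | hk
    · rw [hadd.aStar_of_nonneg hθ hk hπ, hadd.aStar_of_nonneg hθ hk hπ', hadd.Φ_of_nonneg hθ hk]
      linarith
    · rw [hadd.Φ_of_neg hθ hk, hadd.aStar_of_neg hθ hk π', sub_self, zero_mul, zero_mul, zero_mul, mul_zero]
      have h1 : 0 ≤ π * M.φ := mul_nonneg (M.incomes_nonneg hθ hπ) M.φ_mem.1
      split_ifs with h2
      -- A report of zero is audited even without royalties, but then the penalty is `π φ ≥ 0`, so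
      -- it cannot be a profitable lie.
      · have h3 : π' = 0 := le_antisymm h2 (M.incomes_nonneg hθ hπ')
        rw [h3]
        linarith
      · linarith
  · intro θ hθ θ' hθ'
    rw [hval θ' hθ' θ hθ, hval θ hθ θ hθ]
    have h1 := hreg.subgradient hadd hθ' hθ
    have h2 := intervalIntegral.integral_add_adjacent_intervals
      (netShare_intervalIntegrable (M := M) M.θlo θ') (netShare_intervalIntegrable θ' θ)
    linarith
  · intro θ hθ
    rw [hval θ hθ θ hθ, sub_self, mul_zero, add_zero]
    refine intervalIntegral.integral_nonneg hθ.1 fun z _ => ?_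
    have h1 := M.φ_mem.2
    unfold netShare
    split_ifs <;> linarith

end Star

/-! ### Arbitrary feasible mechanisms: the charge as a function of income -/

/-- What an agent with income `π` pays after the type report `θ'` if he reports his income as
truthfully as possible. -/
noncomputable def charge (M : AuctionModel) (D : DirectMechanism) (θ' π : ℝ) : ℝ :=
  D.r θ' (M.proj θ' π) + D.a θ' (M.proj θ' π) * D.p θ' (M.proj θ' π) π

theorem u_proj (M : AuctionModel) (D : DirectMechanism) (θ' π : ℝ) :
    u D θ' (M.proj θ' π) π = D.q θ' * (π - M.charge D θ' π) := by
  rw [u, charge]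
  ring

namespace IsFeasible

variable {M : AuctionModel} {D : DirectMechanism}

theorem charge_le (hD : M.IsFeasible D) {θ' : ℝ} (hθ' : θ' ∈ M.types) (hq : 0 < D.q θ')
    {π π' : ℝ} (hπ : π ∈ M.incomes θ') (hπ' : π' ∈ M.incomes θ') :
    M.charge D θ' π ≤ D.r θ' π' + D.a θ' π' * D.p θ' π' π := by
  have h1 := hD.ic_income θ' hθ' π hπ π' hπ'
  simp only [u] at h1
  have h2 := le_of_mul_le_mul_left h1 hq
  rw [charge, M.proj_of_mem hπ]
  linarith

/-- An agent with income `π₂` may report `π₁`. Relative to the charge at `π₁` this costs only the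
increase of the penalty, at most `φ (π₂ - π₁)`, and only in the event of an audit at `π₁`. -/
theorem charge_sub_le (hD : M.IsFeasible D) {θ' : ℝ} (hθ' : θ' ∈ M.types) (hq : 0 < D.q θ')
    {π₁ π₂ : ℝ} (h₁ : π₁ ∈ M.incomes θ') (h₂ : π₂ ∈ M.incomes θ') (hlt : π₁ < π₂) :
    M.charge D θ' π₂ - M.charge D θ' π₁ ≤ M.φ * D.a θ' π₁ * (π₂ - π₁) := by
  have h3 := hD.charge_le hθ' hq h₂ h₁
  have h4 := (hD.double_monotone θ' hθ' π₁ h₁ π₁ (M.incomes_subset hθ' h₁) π₂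
    (M.incomes_subset hθ' h₂) hlt).2
  have h5 := mul_le_mul_of_nonneg_left h4 (hD.a_mem θ' hθ' π₁ h₁).1
  have h6 : M.charge D θ' π₁ = D.r θ' π₁ + D.a θ' π₁ * D.p θ' π₁ π₁ := by
    rw [charge, M.proj_of_mem h₁]
  linarith

/-- Underreporting bounds the slope from above. Overreporting bounds it from below, since penalties
do not decrease in realized income. -/
theorem charge_sub_mem_of_incomes (hD : M.IsFeasible D) {θ' : ℝ} (hθ' : θ' ∈ M.types)
    (hq : 0 < D.q θ') {π₁ π₂ : ℝ} (h₁ : π₁ ∈ M.incomes θ') (h₂ : π₂ ∈ M.incomes θ')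
    (hle : π₁ ≤ π₂) :
    M.charge D θ' π₂ - M.charge D θ' π₁ ∈ Icc 0 (M.φ * (π₂ - π₁)) := by
  rcases hle.eq_or_lt with rfl | hlt
  · simp
  constructor
  · have h3 := hD.charge_le hθ' hq h₁ h₂
    have h4 := (hD.double_monotone θ' hθ' π₂ h₂ π₁ (M.incomes_subset hθ' h₁) π₂
      (M.incomes_subset hθ' h₂) hlt).1
    have h5 := mul_nonneg (hD.a_mem θ' hθ' π₂ h₂).1 h4
    have h6 : M.charge D θ' π₂ = D.r θ' π₂ + D.a θ' π₂ * D.p θ' π₂ π₂ := by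
      rw [charge, M.proj_of_mem h₂]
    linarith
  · refine (hD.charge_sub_le hθ' hq h₁ h₂ hlt).trans ?_
    refine mul_le_mul_of_nonneg_right ?_ (sub_nonneg.2 hle)
    exact mul_le_of_le_one_right M.φ_mem.1 (hD.a_mem θ' hθ' π₁ h₁).2

/-- When the report is the same, only the penalty varies, and double monotonicity bounds it. -/
theorem charge_sub_mem_of_proj_eq (hD : M.IsFeasible D) {θ' : ℝ} (hθ' : θ' ∈ M.types)
    {π₁ π₂ : ℝ} (h₁ : π₁ ∈ M.allIncomes) (h₂ : π₂ ∈ M.allIncomes) (hle : π₁ ≤ π₂)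
    (heq : M.proj θ' π₁ = M.proj θ' π₂) :
    M.charge D θ' π₂ - M.charge D θ' π₁ ∈ Icc 0 (M.φ * (π₂ - π₁)) := by
  rcases hle.eq_or_lt with rfl | hlt
  · simp
  have hx := M.proj_mem hθ' π₂
  have ha := hD.a_mem θ' hθ' _ hx
  have hp := hD.double_monotone θ' hθ' _ hx π₁ h₁ π₂ h₂ hlt
  have e : M.charge D θ' π₂ - M.charge D θ' π₁ = D.a θ' (M.proj θ' π₂) *
      (D.p θ' (M.proj θ' π₂) π₂ - D.p θ' (M.proj θ' π₂) π₁) := by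
    rw [charge, charge, heq]
    ring
  rw [e]
  refine ⟨mul_nonneg ha.1 hp.1, ?_⟩
  have h3 := mul_le_of_le_one_left hp.1 ha.2
  linarith [hp.2]

/-- If the projections differ, `π₁ ≤ proj π₁ ≤ proj π₂ ≤ π₂`. The report is constant on the two
outer pieces, and the middle piece lies in `Π(θ')`. -/
theorem charge_sub_mem (hD : M.IsFeasible D) {θ' : ℝ} (hθ' : θ' ∈ M.types)
    (hq : 0 < D.q θ') {π₁ π₂ : ℝ} (h₁ : π₁ ∈ M.allIncomes) (h₂ : π₂ ∈ M.allIncomes)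
    (hle : π₁ ≤ π₂) :
    M.charge D θ' π₂ - M.charge D θ' π₁ ∈ Icc 0 (M.φ * (π₂ - π₁)) := by
  have hx₁ := M.proj_mem hθ' π₁
  have hx₂ := M.proj_mem hθ' π₂
  by_cases heq : M.proj θ' π₁ = M.proj θ' π₂
  · exact hD.charge_sub_mem_of_proj_eq hθ' h₁ h₂ hle heq
  have hle₁ : π₁ ≤ M.proj θ' π₁ := by
    rcases lt_or_ge (M.πhi θ') (π₁ : EReal) with h3 | h3
    · exact absurd ((M.proj_of_gt hθ' h3).trans
        (M.proj_of_gt hθ' (h3.trans_le (EReal.coe_le_coe_iff.2 hle))).symm) heq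
    · rcases lt_or_ge π₁ (M.πlo θ') with h4 | h4
      · rw [M.proj_of_lt hθ' h4]
        exact h4.le
      · rw [M.proj_of_mem ⟨h4, h3⟩]
  have hle₂ : M.proj θ' π₂ ≤ π₂ := by
    rcases lt_or_ge π₂ (M.πlo θ') with h4 | h4
    · exact absurd ((M.proj_of_lt hθ' (hle.trans_lt h4)).trans (M.proj_of_lt hθ' h4).symm) heq
    · rcases lt_or_ge (M.πhi θ') (π₂ : EReal) with h3 | h3
      · rw [M.proj_of_gt hθ' h3]
        rw [← M.πhi_eq_coe hθ' h3] at h3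
        exact (EReal.coe_lt_coe_iff.1 h3).le
      · rw [M.proj_of_mem ⟨h4, h3⟩]
  have hle₁₂ : M.proj θ' π₁ ≤ M.proj θ' π₂ := by
    rcases lt_or_ge π₁ (M.πlo θ') with h4 | h4
    · rw [M.proj_of_lt hθ' h4]
      exact hx₂.1
    · rcases lt_or_ge (M.πhi θ') (π₂ : EReal) with h3 | h3
      · rw [M.proj_of_gt hθ' h3]
        have := hx₁.2
        rw [← M.πhi_eq_coe hθ' h3] at this
        exact EReal.coe_le_coe_iff.1 this
      · rw [M.proj_of_mem ⟨h4, (EReal.coe_le_coe_iff.2 hle).trans h3⟩,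
          M.proj_of_mem ⟨h4.trans hle, h3⟩]
        exact hle
  have e1 := hD.charge_sub_mem_of_proj_eq hθ' h₁ (M.incomes_subset hθ' hx₁) hle₁
    (M.proj_of_mem hx₁).symm
  have e2 := hD.charge_sub_mem_of_incomes hθ' hq hx₁ hx₂ hle₁₂
  have e3 := hD.charge_sub_mem_of_proj_eq hθ' (M.incomes_subset hθ' hx₂) h₂ hle₂
    (M.proj_of_mem hx₂)
  constructor
  · linarith [e1.1, e2.1, e3.1]
  · linarith [e1.2, e2.2, e3.2]

theorem measurableSet_incomes (θ : ℝ) : MeasurableSet (M.incomes θ) :=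
  measurableSet_Ici.inter (measurable_coe_real_ereal measurableSet_Iic)

/-- The charge is monotone, hence measurable on the support, and it grows no faster than income,
which is integrable. -/
theorem charge_integrable {εlo : ℝ} {εhi : EReal} {h : ℝ → ℝ} (hadd : M.AdditiveErrors εlo εhi h)
    (hD : M.IsFeasible D) {θ' θ : ℝ} (hθ' : θ' ∈ M.types)
    (hq : 0 < D.q θ') (hθ : θ ∈ M.types) :
    Integrable fun π => M.charge D θ' π * M.g θ π := by
  have hg : Integrable (M.g θ) := integrable_of_integral_eq_one (M.g_integral θ hθ)
  have hmono : MonotoneOn (M.charge D θ') (M.incomes θ) := fun x hx y hy hxy => by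
    have := (hD.charge_sub_mem hθ' hq (M.incomes_subset hθ hx) (M.incomes_subset hθ hy) hxy).1
    linarith
  have hmeas : AEStronglyMeasurable ((M.incomes θ).indicator (M.charge D θ')) volume :=
    (aestronglyMeasurable_indicator_iff (measurableSet_incomes θ)).2
      (aemeasurable_restrict_of_monotoneOn (measurableSet_incomes θ) hmono).aestronglyMeasurable
  have e : (fun π => M.charge D θ' π * M.g θ π) =
      fun π => (M.incomes θ).indicator (M.charge D θ') π * M.g θ π := by
    ext π
    by_cases hπ : π ∈ M.incomes θ
    · rw [indicator_of_mem hπ]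
    · rw [indicator_of_notMem hπ, M.g_eq_zero θ hθ π hπ, mul_zero, zero_mul]
  set π₀ := M.πlo θ with hπ₀
  have h0 : π₀ ∈ M.incomes θ := M.πlo_mem_incomes hθ
  have hB : Integrable fun π => (|M.charge D θ' π₀| + |π₀|) * M.g θ π + π * M.g θ π :=
    (hg.const_mul _).add (M.income_integrable θ hθ)
  refine Integrable.mono' hB ?_ ?_
  · rw [e]
    exact hmeas.mul hg.aestronglyMeasurable
  · filter_upwards [hadd.ae_g_inner_or_zero hθ] with π hπ
    rcases hπ with hπ | hπ
    · have hπ' := M.innerIncomes_subset θ hπ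
      have h1 := hD.charge_sub_mem hθ' hq (M.incomes_subset hθ h0) (M.incomes_subset hθ hπ') hπ'.1
      have hgpos := M.g_pos θ hθ π hπ.1 hπ.2
      rw [Real.norm_eq_abs, abs_mul, abs_of_pos hgpos, ← add_mul]
      refine mul_le_mul_of_nonneg_right ?_ hgpos.le
      have h2 : M.φ * (π - π₀) ≤ π - π₀ :=
        mul_le_of_le_one_left (sub_nonneg.2 hπ'.1) M.φ_mem.2
      rw [abs_le]
      constructor
      · linarith [h1.1, neg_abs_le (M.charge D θ' π₀), abs_nonneg π₀, M.incomes_nonneg hθ hπ']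
      · linarith [h1.2, le_abs_self (M.charge D θ' π₀), neg_abs_le π₀]
    · simp [hπ]

theorem U_eq {εlo : ℝ} {εhi : EReal} {h : ℝ → ℝ} (hadd : M.AdditiveErrors εlo εhi h)
    (hD : M.IsFeasible D) {θ' θ : ℝ} (hθ' : θ' ∈ M.types)
    (hθ : θ ∈ M.types) :
    M.U D θ' θ = D.q θ' * (θ - M.expIncome θ (M.charge D θ')) := by
  rcases (hD.q_mem θ' hθ').1.eq_or_lt with hq | hq
  · simp [U, expIncome, u, ← hq]
  · have e : ∀ π, u D θ' (M.proj θ' π) π * M.g θ π =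
        D.q θ' * (π * M.g θ π - M.charge D θ' π * M.g θ π) := by
      intro π
      rw [u_proj]
      ring
    simp only [U, expIncome, e]
    rw [integral_const_mul, integral_sub (M.income_integrable θ hθ)
      (hD.charge_integrable hadd hθ' hq hθ), M.income_mean θ hθ]

end IsFeasible

/-! ### Audit probabilities and imitation by slightly higher types -/

/-- The set of pairs of a type and a possible income of this type. -/
def typeIncomes (M : AuctionModel) : Set (ℝ × ℝ) := {x | x.1 ∈ M.types ∧ x.2 ∈ M.incomes x.1}

/-- The probability that a type is audited if he buys the asset and reports truthfully; errors
have density `h`. -/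
noncomputable def auditProb (M : AuctionModel) (h : ℝ → ℝ) (D : DirectMechanism) (θ : ℝ) : ℝ :=
  ∫ ε, M.typeIncomes.indicator (fun x => D.a x.1 x.2) (θ, θ + ε) * h ε

namespace IsFeasible

variable {M : AuctionModel} {D : DirectMechanism} {εlo : ℝ} {εhi : EReal} {h : ℝ → ℝ}

theorem measurableSet_typeIncomes (hadd : M.AdditiveErrors εlo εhi h) :
    MeasurableSet M.typeIncomes := by
  have e : M.typeIncomes = {x : ℝ × ℝ | x.1 ∈ Icc M.θlo M.θhi} ∩
      ({x | εlo ≤ x.2 - x.1} ∩ {x | ((x.2 - x.1 : ℝ) : EReal) ∈ Iic εhi}) := by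
    ext x
    refine and_congr_right fun hx => ?_
    have := hadd.mem_incomes_iff hx (ε := x.2 - x.1)
    rw [add_sub_cancel] at this
    exact this
  have hm : Measurable fun x : ℝ × ℝ => x.2 - x.1 := by fun_prop
  rw [e]
  exact (measurable_fst measurableSet_Icc).inter ((measurableSet_le measurable_const hm).inter
    ((measurable_coe_real_ereal.comp hm) measurableSet_Iic))

theorem measurable_indicator_of_domRestrict {α : Type*} [MeasurableSpace α] {s : Set α}
    {d : α → ℝ} (hs : MeasurableSet s) (hd : Measurable (s.domRestrict d)) :
    Measurable (s.indicator d) := by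
  refine measurable_of_restrict_of_restrict_compl hs ?_ ?_
  · convert hd using 1
    ext x
    exact indicator_of_mem x.2 d
  · convert (measurable_const : Measurable fun _ : ↥sᶜ => (0 : ℝ)) using 1
    ext x
    exact indicator_of_notMem x.2 d

theorem audit_measurable (hadd : M.AdditiveErrors εlo εhi h) (hD : M.IsFeasible D) :
    Measurable (M.typeIncomes.indicator fun x => D.a x.1 x.2) :=
  measurable_indicator_of_domRestrict (measurableSet_typeIncomes hadd) hD.a_measurable

theorem audit_mem (hD : M.IsFeasible D) (x : ℝ × ℝ) :
    M.typeIncomes.indicator (fun x => D.a x.1 x.2) x ∈ Icc (0 : ℝ) 1 := by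
  by_cases hx : x ∈ M.typeIncomes
  · rw [indicator_of_mem hx]
    exact hD.a_mem x.1 hx.1 x.2 hx.2
  · rw [indicator_of_notMem hx]
    simp

theorem audit_integrable (hadd : M.AdditiveErrors εlo εhi h) (hD : M.IsFeasible D) (θ : ℝ) :
    Integrable fun ε => M.typeIncomes.indicator (fun x => D.a x.1 x.2) (θ, θ + ε) * h ε := by
  refine hadd.h_integrable.bdd_mul (c := 1) ?_ (Filter.Eventually.of_forall fun ε => ?_)
  · exact ((hD.audit_measurable hadd).comp (by fun_prop)).aestronglyMeasurable
  · have := hD.audit_mem (θ, θ + ε)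
    rw [Real.norm_eq_abs, abs_of_nonneg this.1]
    exact this.2

theorem auditProb_aestronglyMeasurable (hadd : M.AdditiveErrors εlo εhi h)
    (hD : M.IsFeasible D) : AEStronglyMeasurable (M.auditProb h D) volume := by
  refine AEStronglyMeasurable.integral_prod_right' (μ := volume) (ν := volume)
    (f := fun x : ℝ × ℝ =>
      M.typeIncomes.indicator (fun x => D.a x.1 x.2) (x.1, x.1 + x.2) * h x.2) ?_
  exact ((hD.audit_measurable hadd).comp (by fun_prop)).aestronglyMeasurable.mul
    hadd.h_integrable.aestronglyMeasurable.comp_snd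

theorem auditProb_mem (hadd : M.AdditiveErrors εlo εhi h) (hD : M.IsFeasible D) (θ : ℝ) :
    M.auditProb h D θ ∈ Icc (0 : ℝ) 1 := by
  constructor
  · refine integral_nonneg_of_ae ?_
    filter_upwards [hadd.ae_h_nonneg] with ε hε
    exact mul_nonneg (hD.audit_mem _).1 hε
  · rw [← hadd.h_integral]
    refine integral_mono_ae (hD.audit_integrable hadd θ) hadd.h_integrable ?_
    filter_upwards [hadd.ae_h_nonneg] with ε hε
    exact mul_le_of_le_one_left hε (hD.audit_mem _).2

/-- The probability that an increase of the error by `δ` leads out of the support. -/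
noncomputable def exitProb (εhi : EReal) (h : ℝ → ℝ) (δ : ℝ) : ℝ :=
  ∫ ε, {ε : ℝ | εhi < ((ε + δ : ℝ) : EReal)}.indicator h ε

theorem measurableSet_exit (εhi : EReal) (δ : ℝ) :
    MeasurableSet {ε : ℝ | εhi < ((ε + δ : ℝ) : EReal)} :=
  (measurable_coe_real_ereal.comp (measurable_id.add_const δ)) measurableSet_Ioi

/-- Dominated convergence: an error strictly inside the support stays there after a small enough
shift. -/
theorem tendsto_exitProb (hadd : M.AdditiveErrors εlo εhi h) :
    Filter.Tendsto (exitProb εhi h) (nhdsWithin 0 (Ioi 0)) (nhds 0) := by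
  suffices hsuff : Filter.Tendsto (exitProb εhi h) (nhdsWithin 0 (Ioi 0))
      (nhds (∫ _ : ℝ, (0 : ℝ))) by rwa [integral_zero] at hsuff
  refine tendsto_integral_filter_of_dominated_convergence (fun ε => |h ε|) ?_ ?_
    hadd.h_integrable.abs ?_
  · exact Filter.Eventually.of_forall fun δ =>
      hadd.h_integrable.aestronglyMeasurable.indicator (measurableSet_exit εhi δ)
  · exact Filter.Eventually.of_forall fun δ => Filter.Eventually.of_forall fun ε =>
      norm_indicator_le_norm_self _ _
  · filter_upwards [hadd.ae_inner_or_zero] with ε hε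
    refine tendsto_const_nhds.congr' ?_
    rcases hε with hε | hε
    · have hc : Filter.Tendsto (fun δ : ℝ => ((ε + δ : ℝ) : EReal)) (nhdsWithin 0 (Ioi 0))
          (nhds ((ε + 0 : ℝ) : EReal)) :=
        ((continuous_coe_real_ereal.comp (continuous_const_add ε)).tendsto 0).mono_left
          nhdsWithin_le_nhds
      rw [add_zero] at hc
      filter_upwards [hc.eventually_lt_const hε.2] with δ hδ
      have hnot : ε ∉ {ε : ℝ | εhi < ((ε + δ : ℝ) : EReal)} := fun hx => lt_asymm hx hδ
      exact (indicator_of_notMem hnot h).symm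
    · refine Filter.Eventually.of_forall fun δ => ?_
      simp [indicator, hε]

/-- Both expectations are taken over the same error, so the incomes compared differ by `δ`. If the
higher one stays in `Π(θ')`, the slope bound with the audit probability applies; if it leaves, only
the crude slope `φ` is available, which gives the term `exitProb`. -/
theorem expIncome_charge_sub_le (hadd : M.AdditiveErrors εlo εhi h) (hD : M.IsFeasible D)
    {θ' δ : ℝ} (hθ' : θ' ∈ M.types) (hq : 0 < D.q θ') (hδ : 0 < δ) (hθ : θ' + δ ∈ M.types) :
    M.expIncome (θ' + δ) (M.charge D θ') - M.expIncome θ' (M.charge D θ') ≤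
      M.φ * δ * (M.auditProb h D θ' + exitProb εhi h δ) ∧
    M.expIncome (θ' + δ) (M.charge D θ') - M.expIncome θ' (M.charge D θ') ≤ M.φ * δ := by
  have hint : ∀ θ ∈ M.types, Integrable fun ε => M.charge D θ' (θ + ε) * h ε := by
    intro θ hθ
    have h1 := (hD.charge_integrable hadd hθ' hq hθ).comp_add_left θ
    refine h1.congr (Filter.Eventually.of_forall fun ε => ?_)
    simp only [hadd.g_eq θ hθ, add_sub_cancel_left]
  have hex : Integrable ({ε : ℝ | εhi < ((ε + δ : ℝ) : EReal)}.indicator h) :=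
    hadd.h_integrable.indicator (measurableSet_exit εhi δ)
  have hi1 := hint _ hθ
  have hi0 := hint _ hθ'
  have hall : ∀ ε : ℝ, εlo < ε → (ε : EReal) < εhi →
      θ' + ε ∈ M.incomes θ' ∧ θ' + δ + ε ∈ M.allIncomes := fun ε h1 h2 =>
    ⟨M.innerIncomes_subset _ ((hadd.mem_innerIncomes_iff hθ').2 ⟨h1, h2⟩),
      M.incomes_subset hθ (M.innerIncomes_subset _ ((hadd.mem_innerIncomes_iff hθ).2 ⟨h1, h2⟩))⟩
  rw [hadd.expIncome_eq hθ, hadd.expIncome_eq hθ', ← integral_sub hi1 hi0]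
  have hupper : ∀ ε : ℝ, εlo < ε → (ε : EReal) < εhi →
      M.charge D θ' (θ' + δ + ε) - M.charge D θ' (θ' + ε) ≤ M.φ * δ := by
    intro ε h1 h2
    obtain ⟨h3, h4⟩ := hall ε h1 h2
    have := (hD.charge_sub_mem hθ' hq (M.incomes_subset hθ' h3) h4 (by linarith)).2
    rwa [show θ' + δ + ε - (θ' + ε) = δ by ring] at this
  constructor
  · rw [auditProb, exitProb, ← integral_add (hD.audit_integrable hadd θ') hex,
      ← integral_const_mul]
    refine integral_mono_ae (hi1.sub hi0)
      (((hD.audit_integrable hadd θ').add hex).const_mul _) ?_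
    filter_upwards [hadd.ae_inner_or_zero] with ε hε
    rcases hε with ⟨h1, h2⟩ | hε
    · obtain ⟨h3, h4⟩ := hall ε h1 h2
      have hpos := (hadd.h_pos ε h1 h2).le
      have ha := hD.audit_mem (θ', θ' + ε)
      have hφδ := mul_nonneg M.φ_mem.1 hδ.le
      rw [← sub_mul]
      by_cases hexit : εhi < ((ε + δ : ℝ) : EReal)
      · rw [indicator_of_mem (s := {ε : ℝ | εhi < ((ε + δ : ℝ) : EReal)}) hexit]
        have h5 := mul_le_mul_of_nonneg_right (hupper ε h1 h2) hpos
        have h6 := mul_nonneg hφδ (mul_nonneg ha.1 hpos)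
        linarith
      · rw [indicator_of_notMem (s := {ε : ℝ | εhi < ((ε + δ : ℝ) : EReal)}) hexit, add_zero,
          ← mul_assoc]
        refine mul_le_mul_of_nonneg_right ?_ hpos
        have h5 : θ' + (ε + δ) ∈ M.incomes θ' :=
          (hadd.mem_incomes_iff hθ').2 ⟨by linarith, not_lt.1 hexit⟩
        rw [indicator_of_mem (show (θ', θ' + ε) ∈ M.typeIncomes from ⟨hθ', h3⟩)]
        have h6 := hD.charge_sub_le hθ' hq h3 h5 (by linarith)
        rw [show θ' + (ε + δ) - (θ' + ε) = δ by ring] at h6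
        rw [show θ' + δ + ε = θ' + (ε + δ) by ring]
        linarith
    · rw [hε, indicator_apply_eq_zero.2 fun _ => hε]
      simp
  · rw [← mul_one (M.φ * δ), ← hadd.h_integral, ← integral_const_mul]
    refine integral_mono_ae (hi1.sub hi0) (hadd.h_integrable.const_mul _) ?_
    filter_upwards [hadd.ae_inner_or_zero] with ε hε
    rcases hε with ⟨h1, h2⟩ | hε
    · rw [← sub_mul]
      exact mul_le_mul_of_nonneg_right (hupper ε h1 h2) (hadd.h_pos ε h1 h2).le
    · simp [hε]

end IsFeasible

/-! ### Rents -/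

/-- The equilibrium utility of a type. -/
noncomputable def rent (M : AuctionModel) (D : DirectMechanism) (θ : ℝ) : ℝ :=
  M.U D θ θ - D.t θ

/-- The marginal equilibrium utility of a type if the constraints of the agent bind. -/
noncomputable def marginalRent (M : AuctionModel) (h : ℝ → ℝ) (D : DirectMechanism) (θ : ℝ) : ℝ :=
  M.types.indicator D.q θ * (1 - M.φ * M.auditProb h D θ)

/-- The principal's payoff from a type under truthful reporting. -/
noncomputable def typePayoff (M : AuctionModel) (D : DirectMechanism) (θ : ℝ) : ℝ :=
  D.t θ + D.q θ * M.expIncome θ (fun π => D.r θ π + D.a θ π * (D.p θ π π - M.c))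

/-- The virtual surplus of a type, weighted with the density of the type. -/
noncomputable def virtualSurplus (M : AuctionModel) (h : ℝ → ℝ) (D : DirectMechanism)
    (θ : ℝ) : ℝ :=
  M.types.indicator D.q θ * (θ - M.c * M.auditProb h D θ) * M.f θ -
    M.marginalRent h D θ * (1 - M.F θ)

namespace IsFeasible

variable {M : AuctionModel} {D : DirectMechanism} {εlo : ℝ} {εhi : EReal} {h : ℝ → ℝ}

/-- Type `θ + δ` must not gain by reporting `θ`, so the rent rises at least as much as the utility
from that report does. -/
theorem rent_add_le (hadd : M.AdditiveErrors εlo εhi h) (hD : M.IsFeasible D) {θ δ : ℝ}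
    (hθ : θ ∈ M.types) (hδ : 0 < δ) (hθδ : θ + δ ∈ M.types) :
    D.q θ * (δ - M.φ * δ * (M.auditProb h D θ + exitProb εhi h δ)) ≤
        M.rent D (θ + δ) - M.rent D θ ∧ M.rent D θ ≤ M.rent D (θ + δ) := by
  have hic := hD.ic_type (θ + δ) hθδ θ hθ
  have e : M.U D θ (θ + δ) - M.U D θ θ = D.q θ * (δ - (M.expIncome (θ + δ) (M.charge D θ)
      - M.expIncome θ (M.charge D θ))) := by
    rw [hD.U_eq hadd hθ hθδ, hD.U_eq hadd hθ hθ]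
    ring
  have hge : M.U D θ (θ + δ) - M.U D θ θ ≤ M.rent D (θ + δ) - M.rent D θ := by
    unfold rent
    linarith
  rcases (hD.q_mem θ hθ).1.eq_or_lt with hq | hq
  · rw [← hq, zero_mul] at e ⊢
    constructor <;> linarith
  · obtain ⟨h1, h2⟩ := hD.expIncome_charge_sub_le hadd hθ hq hδ hθδ
    constructor
    · refine le_trans ?_ hge
      rw [e]
      exact mul_le_mul_of_nonneg_left (by linarith) hq.le
    · have h3 : M.φ * δ ≤ δ := mul_le_of_le_one_left hδ.le M.φ_mem.2
      have h4 := mul_nonneg hq.le (show 0 ≤ δ - (M.expIncome (θ + δ) (M.charge D θ)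
        - M.expIncome θ (M.charge D θ)) by linarith)
      linarith

theorem rent_monotoneOn (hadd : M.AdditiveErrors εlo εhi h) (hD : M.IsFeasible D) :
    MonotoneOn (M.rent D) M.types := by
  intro x hx y hy hxy
  rcases hxy.eq_or_lt with rfl | hlt
  · exact le_rfl
  · have := (hD.rent_add_le hadd hx (sub_pos.2 hlt) (by rwa [add_sub_cancel])).2
    rwa [add_sub_cancel] at this

/-- Difference quotients from the right suffice, and the exit probability vanishes in the limit. -/
theorem marginalRent_le_deriv (hadd : M.AdditiveErrors εlo εhi h) (hD : M.IsFeasible D) {θ : ℝ}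
    (hθ : θ ∈ Ioo M.θlo M.θhi) (hd : DifferentiableAt ℝ (M.rent D) θ) :
    M.marginalRent h D θ ≤ deriv (M.rent D) θ := by
  have hθ' : θ ∈ M.types := Ioo_subset_Icc_self hθ
  have hslope : Filter.Tendsto (fun δ => δ⁻¹ * (M.rent D (θ + δ) - M.rent D θ))
      (nhdsWithin 0 (Ioi 0)) (nhds (deriv (M.rent D) θ)) := by
    have := (hasDerivAt_iff_tendsto_slope_zero.1 hd.hasDerivAt).mono_left
      (nhdsWithin_mono 0 (t := {0}ᶜ) (s := Ioi 0) fun x (hx : 0 < x) => hx.ne')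
    simpa only [smul_eq_mul] using this
  have hlim : Filter.Tendsto
      (fun δ => D.q θ * (1 - M.φ * (M.auditProb h D θ + exitProb εhi h δ)))
      (nhdsWithin 0 (Ioi 0)) (nhds (D.q θ * (1 - M.φ * (M.auditProb h D θ + 0)))) :=
    (((tendsto_exitProb hadd).const_add _).const_mul _).const_sub _ |>.const_mul _
  rw [marginalRent, indicator_of_mem hθ']
  rw [add_zero] at hlim
  refine le_of_tendsto_of_tendsto hlim hslope ?_
  have hev : ∀ᶠ δ in nhdsWithin (0 : ℝ) (Ioi 0), δ < M.θhi - θ :=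
    mem_nhdsWithin_of_mem_nhds (Iio_mem_nhds (sub_pos.2 hθ.2))
  filter_upwards [self_mem_nhdsWithin, hev] with δ (hδ : 0 < δ) hδ'
  have h1 := (hD.rent_add_le hadd hθ' hδ ⟨by linarith [hθ.1], by linarith⟩).1
  have h2 := mul_le_mul_of_nonneg_left h1 (inv_pos.2 hδ).le
  refine le_trans (le_of_eq ?_) h2
  field_simp

theorem allocation_mem (hD : M.IsFeasible D) (θ : ℝ) :
    M.types.indicator D.q θ ∈ Icc (0 : ℝ) 1 := by
  by_cases hθ : θ ∈ M.types
  · rw [indicator_of_mem hθ]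
    exact hD.q_mem θ hθ
  · rw [indicator_of_notMem hθ]
    simp

theorem allocation_measurable (hD : M.IsFeasible D) : Measurable (M.types.indicator D.q) :=
  measurable_indicator_of_domRestrict measurableSet_Icc hD.q_measurable

theorem marginalRent_mem (hadd : M.AdditiveErrors εlo εhi h) (hD : M.IsFeasible D) (θ : ℝ) :
    M.marginalRent h D θ ∈ Icc (0 : ℝ) 1 := by
  have h1 := hD.allocation_mem θ
  have h2 := hD.auditProb_mem hadd θ
  have h3 := mul_nonneg M.φ_mem.1 h2.1
  have h4 := mul_le_one₀ M.φ_mem.2 h2.1 h2.2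
  exact ⟨mul_nonneg h1.1 (by linarith), mul_le_one₀ h1.2 (by linarith) (by linarith)⟩

theorem marginalRent_aestronglyMeasurable (hadd : M.AdditiveErrors εlo εhi h)
    (hD : M.IsFeasible D) : AEStronglyMeasurable (M.marginalRent h D) volume :=
  hD.allocation_measurable.aestronglyMeasurable.mul
    (aestronglyMeasurable_const.sub ((hD.auditProb_aestronglyMeasurable hadd).const_mul _))

theorem marginalRent_intervalIntegrable (hadd : M.AdditiveErrors εlo εhi h)
    (hD : M.IsFeasible D) (a b : ℝ) : IntervalIntegrable (M.marginalRent h D) volume a b := by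
  refine (intervalIntegrable_const (c := (1 : ℝ))).mono_fun
    (hD.marginalRent_aestronglyMeasurable hadd).restrict (Filter.Eventually.of_forall fun θ => ?_)
  have h1 := hD.marginalRent_mem hadd θ
  simpa [abs_of_nonneg h1.1] using h1.2

/-- A monotone function is differentiable almost everywhere and increases by at least the integral
of its derivative. Only this inequality is needed, together with participation of the lowest type.
-/
theorem integral_marginalRent_le_rent (hadd : M.AdditiveErrors εlo εhi h) (hD : M.IsFeasible D)
    {θ : ℝ} (hθ : θ ∈ M.types) : ∫ z in M.θlo..θ, M.marginalRent h D z ≤ M.rent D θ := by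
  have hmono : MonotoneOn (M.rent D) (uIcc M.θlo θ) := by
    rw [uIcc_of_le hθ.1]
    exact (hD.rent_monotoneOn hadd).mono (Icc_subset_Icc_right hθ.2)
  have hlo : M.θlo ∈ M.types := left_mem_Icc.2 M.θlo_lt_θhi.le
  have hle := hD.rent_monotoneOn hadd hlo hθ hθ.1
  have h1 := hmono.intervalIntegral_deriv_mem_uIcc
  rw [uIcc_of_le (sub_nonneg.2 hle)] at h1
  have h2 : ∫ z in M.θlo..θ, M.marginalRent h D z ≤ ∫ z in M.θlo..θ, deriv (M.rent D) z := by
    refine intervalIntegral.integral_mono_ae_restrict hθ.1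
      (hD.marginalRent_intervalIntegrable hadd _ _) hmono.intervalIntegrable_deriv ?_
    have h3 := (hD.rent_monotoneOn hadd).ae_differentiableWithinAt_of_mem
    have h4 : ∀ᵐ z : ℝ, z ≠ M.θlo := Measure.ae_ne volume _
    have h5 : ∀ᵐ z : ℝ, z ≠ M.θhi := Measure.ae_ne volume _
    rw [Filter.EventuallyLE, ae_restrict_iff' measurableSet_Icc]
    filter_upwards [h3, h4, h5] with z h3 h4 h5 hz
    have hz' : z ∈ M.types := ⟨hz.1, hz.2.trans hθ.2⟩
    have hz'' : z ∈ Ioo M.θlo M.θhi :=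
      ⟨lt_of_le_of_ne hz'.1 h4.symm, lt_of_le_of_ne hz'.2 h5⟩
    exact hD.marginalRent_le_deriv hadd hz''
      ((h3 hz').differentiableAt (Icc_mem_nhds hz''.1 hz''.2))
  have h3 : 0 ≤ M.rent D M.θlo := hD.ir _ hlo
  linarith [h1.2]

/-- Royalties, penalties and prices are pure transfers: the principal gets the surplus net of audit
costs, minus the rent. If `q = 0`, the charge need not be integrable, hence the case distinction. -/
theorem typePayoff_eq (hadd : M.AdditiveErrors εlo εhi h) (hD : M.IsFeasible D) {θ : ℝ}
    (hθ : θ ∈ M.types) :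
    M.typePayoff D θ = D.q θ * (θ - M.c * M.auditProb h D θ) - M.rent D θ := by
  rw [rent, hD.U_eq hadd hθ hθ, typePayoff]
  rcases (hD.q_mem θ hθ).1.eq_or_lt with hq | hq
  · rw [← hq]
    ring
  have hint := hD.charge_integrable hadd hθ hq hθ
  have hA : Integrable fun π => M.typeIncomes.indicator (fun x => D.a x.1 x.2) (θ, π) *
      M.g θ π := by
    have h1 := (hD.audit_integrable hadd θ).comp_sub_right θ
    refine h1.congr (Filter.Eventually.of_forall fun π => ?_)
    simp only [hadd.g_eq θ hθ, add_sub_cancel]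
  have e1 : M.expIncome θ (fun π => D.r θ π + D.a θ π * (D.p θ π π - M.c)) =
      M.expIncome θ (M.charge D θ) - M.c * M.auditProb h D θ := by
    have e2 : M.auditProb h D θ =
        M.expIncome θ fun π => M.typeIncomes.indicator (fun x => D.a x.1 x.2) (θ, π) := by
      rw [hadd.expIncome_eq hθ]
      rfl
    rw [e2, expIncome, expIncome, expIncome, ← integral_const_mul,
      ← integral_sub hint (hA.const_mul _)]
    congr 1
    ext π
    by_cases hπ : π ∈ M.incomes θ
    · rw [charge, M.proj_of_mem hπ,
        indicator_of_mem (show (θ, π) ∈ M.typeIncomes from ⟨hθ, hπ⟩)]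
      ring
    · rw [M.g_eq_zero θ hθ π hπ]
      ring
  rw [e1]
  ring

end IsFeasible

/-! ### Virtual surplus and the upper bound on the payoff -/

theorem integral_types_eq (M : AuctionModel) (X : ℝ → ℝ) :
    M.expType X = ∫ θ in M.θlo..M.θhi, X θ * M.f θ := by
  rw [expType, intervalIntegral.integral_of_le M.θlo_lt_θhi.le, ← integral_Icc_eq_integral_Ioc]
  refine (setIntegral_eq_integral_of_forall_compl_eq_zero fun θ hθ => ?_).symm
  rw [M.f_eq_zero θ hθ, mul_zero]

/-- Integration by parts for a weighted primitive. -/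
theorem integral_primitive_mul_f (M : AuctionModel) {X : ℝ → ℝ}
    (hX : IntervalIntegrable X volume M.θlo M.θhi) :
    ∫ θ in M.θlo..M.θhi, (∫ z in M.θlo..θ, X z) * M.f θ =
      ∫ z in M.θlo..M.θhi, X z * (1 - M.F z) := by
  have hle := M.θlo_lt_θhi.le
  rw [intervalIntegral.integral_of_le hle, intervalIntegral.integral_of_le hle]
  have hX' := hX.1
  have hf' := M.f_integrable.integrableOn (s := Ioc M.θlo M.θhi)
  have hprod : Integrable (fun x : ℝ × ℝ => M.f x.1 * X x.2)
      ((volume.restrict (Ioc M.θlo M.θhi)).prod (volume.restrict (Ioc M.θlo M.θhi))) :=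
    hf'.mul_prod hX'
  have hS : MeasurableSet {x : ℝ × ℝ | x.2 ≤ x.1} :=
    measurableSet_le measurable_snd measurable_fst
  -- Fubini on the triangle `z ≤ θ`; `X` is merely integrable.
  have hswap := integral_integral_swap
    (f := fun θ z => {x : ℝ × ℝ | x.2 ≤ x.1}.indicator (fun x => M.f x.1 * X x.2) (θ, z))
    (hprod.indicator hS)
  have e1 : ∀ θ ∈ Ioc M.θlo M.θhi, ∫ z in Ioc M.θlo M.θhi,
      {x : ℝ × ℝ | x.2 ≤ x.1}.indicator (fun x => M.f x.1 * X x.2) (θ, z) =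
      (∫ z in M.θlo..θ, X z) * M.f θ := by
    intro θ hθ
    have : ∀ z, {x : ℝ × ℝ | x.2 ≤ x.1}.indicator (fun x => M.f x.1 * X x.2) (θ, z) =
        (Iic θ).indicator (fun z => M.f θ * X z) z := fun z => rfl
    simp only [this]
    rw [setIntegral_indicator measurableSet_Iic, Ioc_inter_Iic, min_eq_right hθ.2,
      integral_const_mul, intervalIntegral.integral_of_le hθ.1.le, mul_comm]
  have e2 : ∀ z ∈ Ioc M.θlo M.θhi, ∫ θ in Ioc M.θlo M.θhi,
      {x : ℝ × ℝ | x.2 ≤ x.1}.indicator (fun x => M.f x.1 * X x.2) (θ, z) =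
      X z * (1 - M.F z) := by
    intro z hz
    have : ∀ θ, {x : ℝ × ℝ | x.2 ≤ x.1}.indicator (fun x => M.f x.1 * X x.2) (θ, z) =
        (Ici z).indicator (fun θ => M.f θ * X z) θ := fun θ => rfl
    simp only [this]
    have hset : Ioc M.θlo M.θhi ∩ Ici z = Icc z M.θhi := by
      ext θ
      simp only [mem_inter_iff, mem_Ioc, mem_Ici, mem_Icc]
      exact ⟨fun hx => ⟨hx.2, hx.1.2⟩, fun hx => ⟨⟨hz.1.trans_le hx.1, hx.2⟩, hx.1⟩⟩
    rw [setIntegral_indicator measurableSet_Ici, hset, integral_mul_const,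
      integral_Icc_eq_integral_Ioc, ← intervalIntegral.integral_of_le hz.2, ← M.one_sub_F_eq,
      mul_comm]
  rw [← setIntegral_congr_fun measurableSet_Ioc e1, hswap,
    setIntegral_congr_fun measurableSet_Ioc e2]

namespace IsFeasible

variable {M : AuctionModel} {D : DirectMechanism} {εlo : ℝ} {εhi : EReal} {h : ℝ → ℝ}

theorem surplus_intervalIntegrable (hadd : M.AdditiveErrors εlo εhi h) (hD : M.IsFeasible D) :
    IntervalIntegrable (fun θ => M.types.indicator D.q θ * (θ - M.c * M.auditProb h D θ) * M.f θ)
      volume M.θlo M.θhi := by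
  have h1 : Integrable fun θ => M.types.indicator D.q θ * M.f θ := by
    refine M.f_integrable.bdd_mul (c := 1) hD.allocation_measurable.aestronglyMeasurable
      (Filter.Eventually.of_forall fun θ => ?_)
    have := hD.allocation_mem θ
    rw [Real.norm_eq_abs, abs_of_nonneg this.1]
    exact this.2
  have h2 : Integrable fun θ => M.auditProb h D θ * (M.types.indicator D.q θ * M.f θ) := by
    refine h1.bdd_mul (c := 1) (hD.auditProb_aestronglyMeasurable hadd)
      (Filter.Eventually.of_forall fun θ => ?_)
    have := hD.auditProb_mem hadd θ
    rw [Real.norm_eq_abs, abs_of_nonneg this.1]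
    exact this.2
  have h3 : IntervalIntegrable (fun θ => θ * (M.types.indicator D.q θ * M.f θ))
      volume M.θlo M.θhi := h1.intervalIntegrable.continuousOn_mul continuousOn_id
  refine (h3.sub (h2.intervalIntegrable.const_mul M.c)).congr
    fun θ _ => ?_
  ring

theorem rentBound_intervalIntegrable (hadd : M.AdditiveErrors εlo εhi h) (hD : M.IsFeasible D) :
    IntervalIntegrable (fun θ => (∫ z in M.θlo..θ, M.marginalRent h D z) * M.f θ)
      volume M.θlo M.θhi :=
  M.f_integrable.intervalIntegrable.continuousOn_mul
    (intervalIntegral.continuous_primitive (hD.marginalRent_intervalIntegrable hadd) _).continuousOn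

theorem virtualSurplus_intervalIntegrable (hadd : M.AdditiveErrors εlo εhi h)
    (hD : M.IsFeasible D) :
    IntervalIntegrable (M.virtualSurplus h D) volume M.θlo M.θhi :=
  (hD.surplus_intervalIntegrable hadd).sub
    ((hD.marginalRent_intervalIntegrable hadd _ _).mul_continuousOn
      (continuous_const.sub M.F_continuous).continuousOn)

theorem integral_virtualSurplus (hadd : M.AdditiveErrors εlo εhi h) (hD : M.IsFeasible D) :
    ∫ θ in M.θlo..M.θhi, M.virtualSurplus h D θ =
      ∫ θ in M.θlo..M.θhi, (M.types.indicator D.q θ * (θ - M.c * M.auditProb h D θ) * M.f θ -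
        (∫ z in M.θlo..θ, M.marginalRent h D z) * M.f θ) := by
  have h1 := (hD.marginalRent_intervalIntegrable hadd M.θlo M.θhi).mul_continuousOn
    (continuous_const.sub M.F_continuous).continuousOn (g := fun θ => 1 - M.F θ)
  rw [intervalIntegral.integral_sub (hD.surplus_intervalIntegrable hadd)
    (hD.rentBound_intervalIntegrable hadd),
    M.integral_primitive_mul_f (hD.marginalRent_intervalIntegrable hadd _ _),
    ← intervalIntegral.integral_sub (hD.surplus_intervalIntegrable hadd) h1]
  rfl

theorem rent_mul_f_intervalIntegrable (hadd : M.AdditiveErrors εlo εhi h)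
    (hD : M.IsFeasible D) :
    IntervalIntegrable (fun θ => M.rent D θ * M.f θ) volume M.θlo M.θhi := by
  have hle := M.θlo_lt_θhi.le
  have hmono := hD.rent_monotoneOn hadd
  rw [intervalIntegrable_iff_integrableOn_Icc_of_le hle]
  refine M.f_integrable.integrableOn.bdd_mul (c := |M.rent D M.θlo| + |M.rent D M.θhi|)
    (aemeasurable_restrict_of_monotoneOn measurableSet_Icc hmono).aestronglyMeasurable
    ((ae_restrict_iff' measurableSet_Icc).2 (Filter.Eventually.of_forall fun θ hθ => ?_))
  have h1 := hmono (left_mem_Icc.2 hle) hθ hθ.1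
  have h2 := hmono hθ (right_mem_Icc.2 hle) hθ.2
  rw [Real.norm_eq_abs, abs_le]
  constructor
  · linarith [neg_abs_le (M.rent D M.θlo), abs_nonneg (M.rent D M.θhi)]
  · linarith [le_abs_self (M.rent D M.θhi), abs_nonneg (M.rent D M.θlo)]

theorem payoff_eq (hadd : M.AdditiveErrors εlo εhi h) (hD : M.IsFeasible D) :
    M.payoff D = ∫ θ in M.θlo..M.θhi, (M.types.indicator D.q θ *
      (θ - M.c * M.auditProb h D θ) * M.f θ - M.rent D θ * M.f θ) := by
  change M.expType (M.typePayoff D) = _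
  rw [M.integral_types_eq]
  refine intervalIntegral.integral_congr fun θ hθ => ?_
  rw [uIcc_of_le M.θlo_lt_θhi.le] at hθ
  rw [hD.typePayoff_eq hadd hθ, indicator_of_mem (s := M.types) hθ, sub_mul]

theorem payoff_le (hadd : M.AdditiveErrors εlo εhi h) (hD : M.IsFeasible D) :
    M.payoff D ≤ ∫ θ in M.θlo..M.θhi, M.virtualSurplus h D θ := by
  rw [hD.integral_virtualSurplus hadd, hD.payoff_eq hadd]
  refine intervalIntegral.integral_mono_on M.θlo_lt_θhi.le
    ((hD.surplus_intervalIntegrable hadd).sub (hD.rent_mul_f_intervalIntegrable hadd))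
    ((hD.surplus_intervalIntegrable hadd).sub (hD.rentBound_intervalIntegrable hadd))
    fun θ hθ => ?_
  exact sub_le_sub_left (mul_le_mul_of_nonneg_right
    (hD.integral_marginalRent_le_rent hadd hθ) (M.f_nonneg θ)) _

/-- The virtual surplus is a product of the virtual value for the given auditing probability, the
allocation probability, and the density. -/
theorem virtualSurplus_eq {θ : ℝ} (hθ : θ ∈ Ioo M.θlo M.θhi) :
    M.virtualSurplus h D θ = M.f θ * (M.types.indicator D.q θ *
      (θ - M.invHazard θ + M.auditProb h D θ * M.auditGain θ)) := by
  have hf := (M.f_pos θ hθ).ne'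
  rw [virtualSurplus, marginalRent, auditGain, invHazard]
  field_simp
  ring

/-- For a given type the expression is affine in the audit probability and then in `q`, both in `[0,
1]`; so the positive parts bound it. -/
theorem virtualSurplus_le (hadd : M.AdditiveErrors εlo εhi h) (hD : M.IsFeasible D) {θ : ℝ}
    (hθ : θ ∈ Ioo M.θlo M.θhi) : M.virtualSurplus h D θ ≤ M.f θ * (M.qStar θ * M.ψ θ) := by
  have hq := hD.allocation_mem θ
  have hA := hD.auditProb_mem hadd θ
  rw [virtualSurplus_eq hθ]
  refine mul_le_mul_of_nonneg_left ?_ (M.f_nonneg θ)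
  have h1 : M.auditProb h D θ * M.auditGain θ ≤ max (M.auditGain θ) 0 :=
    (mul_le_mul_of_nonneg_left (le_max_left _ 0) hA.1).trans
      (mul_le_of_le_one_left (le_max_right _ _) hA.2)
  have h2 := mul_le_mul_of_nonneg_left (show θ - M.invHazard θ +
    M.auditProb h D θ * M.auditGain θ ≤ M.ψ θ by
      rw [hadd.ψ_eq (Ioo_subset_Icc_self hθ)]
      linarith) hq.1
  refine h2.trans ?_
  rw [qStar]
  split_ifs with h3
  · exact mul_le_mul_of_nonneg_right hq.2 h3.1.le
  · rw [zero_mul]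
    exact mul_nonpos_of_nonneg_of_nonpos hq.1 (not_lt.1 fun h4 => h3 ⟨h4, fun h5 => hθ.1.ne' h5.1⟩)

end IsFeasible

/-! ### Optimality of the starred mechanism -/

section Star

variable {M : AuctionModel} {εlo : ℝ} {εhi : EReal} {h : ℝ → ℝ}

theorem AdditiveErrors.auditProb_star (hadd : M.AdditiveErrors εlo εhi h) {θ : ℝ}
    (hθ : θ ∈ M.types) : M.auditProb h M.star θ = if 0 ≤ M.auditGain θ then 1 else 0 := by
  have e : (fun ε => M.typeIncomes.indicator (fun x => M.star.a x.1 x.2) (θ, θ + ε) * h ε)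
      =ᵐ[volume] fun ε => (if 0 ≤ M.auditGain θ then 1 else 0) * h ε := by
    filter_upwards [hadd.ae_inner_or_zero] with ε hε
    rcases hε with hε | hε
    · have hmem := (hadd.mem_innerIncomes_iff hθ).2 hε
      have hmem' := M.innerIncomes_subset θ hmem
      rw [indicator_of_mem (show (θ, θ + ε) ∈ M.typeIncomes from ⟨hθ, hmem'⟩)]
      change M.aStar θ (θ + ε) * h ε = _
      split_ifs with hk
      · rw [hadd.aStar_of_nonneg hθ hk hmem']
      · rw [hadd.aStar_of_neg hθ (not_le.1 hk),
          if_neg (not_le.2 (M.innerIncomes_pos hθ hmem))]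
    · rw [hε, mul_zero, mul_zero]
  rw [auditProb, integral_congr_ae e, integral_const_mul, hadd.h_integral, mul_one]

theorem AdditiveErrors.virtualSurplus_star (hadd : M.AdditiveErrors εlo εhi h) {θ : ℝ}
    (hθ : θ ∈ Ioo M.θlo M.θhi) :
    M.virtualSurplus h M.star θ = M.f θ * (M.qStar θ * M.ψ θ) := by
  have hθ' : θ ∈ M.types := Ioo_subset_Icc_self hθ
  rw [IsFeasible.virtualSurplus_eq hθ, hadd.auditProb_star hθ', hadd.ψ_eq hθ',
    indicator_of_mem hθ']
  change M.f θ * (M.qStar θ * _) = _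
  congr 3
  split_ifs with hk
  · rw [one_mul, max_eq_left hk]
  · rw [zero_mul, max_eq_right (not_le.1 hk).le]

/-- The lower bound on rents binds for every type, so the payoff of this mechanism equals its
virtual surplus. -/
theorem AdditiveErrors.rent_star (hadd : M.AdditiveErrors εlo εhi h) {θ : ℝ} (hθ : θ ∈ M.types) :
    M.rent M.star θ = ∫ z in M.θlo..θ, M.marginalRent h M.star z := by
  rw [rent, hadd.U_star hθ hθ]
  change _ - M.tStar θ = _
  rw [hadd.tStar_eq hθ, sub_sub_cancel, intervalIntegral.integral_of_le hθ.1,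
    intervalIntegral.integral_of_le hθ.1]
  refine setIntegral_congr_fun measurableSet_Ioc fun z hz => ?_
  have hz' : z ∈ M.types := ⟨hz.1.le, hz.2.trans hθ.2⟩
  rw [marginalRent, indicator_of_mem hz', hadd.auditProb_star hz', hadd.Φ_eq hz', mul_ite, mul_one,
    mul_zero]
  rfl

theorem Regular.payoff_star (hreg : M.Regular) (hadd : M.AdditiveErrors εlo εhi h) :
    M.payoff M.star = ∫ θ in M.θlo..M.θhi, M.virtualSurplus h M.star θ := by
  have hD := hreg.star_isFeasible hadd
  rw [hD.integral_virtualSurplus hadd, hD.payoff_eq hadd]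
  refine intervalIntegral.integral_congr fun θ hθ => ?_
  rw [uIcc_of_le M.θlo_lt_θhi.le] at hθ
  rw [hadd.rent_star hθ]

theorem Regular.star_isOptimal (hreg : M.Regular) (hadd : M.AdditiveErrors εlo εhi h) :
    M.IsOptimal M.star := by
  have hstar := hreg.star_isFeasible hadd
  refine ⟨hstar, fun D hD => (hD.payoff_le hadd).trans ?_⟩
  rw [hreg.payoff_star hadd]
  refine intervalIntegral.integral_mono_on_of_le_Ioo M.θlo_lt_θhi.le
    (hD.virtualSurplus_intervalIntegrable hadd) (hstar.virtualSurplus_intervalIntegrable hadd)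
    fun θ hθ => ?_
  rw [hadd.virtualSurplus_star hθ]
  exact hD.virtualSurplus_le hadd hθ

end Star

/-! ### Implementation by a menu -/

variable {M : AuctionModel} {εlo : ℝ} {εhi : EReal} {h : ℝ → ℝ}

theorem decisionValue_of_profit {θ : ℝ} (hθ : θ ∈ M.types) {C : RoyaltyContract} {s b : ℝ}
    (hC : ∀ π, C.profit π π = s * π - b) : M.decisionValue θ (some C) = s * θ - b := by
  have hg : Integrable (M.g θ) := integrable_of_integral_eq_one (M.g_integral θ hθ)
  have e : ∀ π, C.profit π π * M.g θ π = s * (π * M.g θ π) - b * M.g θ π := fun π => by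
    rw [hC]
    ring
  simp only [decisionValue, expIncome, e]
  rw [integral_sub ((M.income_integrable θ hθ).const_mul s) (hg.const_mul b),
    integral_const_mul, integral_const_mul, M.income_mean θ hθ, M.g_integral θ hθ, mul_one]

theorem decisionValue_lumpSum {θ : ℝ} (hθ : θ ∈ M.types) (b : ℝ) :
    M.decisionValue θ (some (RoyaltyContract.lumpSum b)) = θ - b := by
  rw [decisionValue_of_profit hθ (s := 1) (b := b), one_mul]
  intro π
  simp only [RoyaltyContract.profit, RoyaltyContract.lumpSum]
  ring

theorem decisionValue_linearRoyalty {θ : ℝ} (hθ : θ ∈ M.types) (b : ℝ) :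
    M.decisionValue θ (some (RoyaltyContract.linearRoyalty M.φ b)) = (1 - M.φ) * θ - b := by
  refine decisionValue_of_profit hθ fun π => ?_
  simp only [RoyaltyContract.profit, RoyaltyContract.linearRoyalty]
  ring

theorem lumpSum_profit_le (b π' π : ℝ) :
    (RoyaltyContract.lumpSum b).profit π' π ≤ (RoyaltyContract.lumpSum b).profit π π := by
  simp [RoyaltyContract.profit, RoyaltyContract.lumpSum]

theorem linearRoyalty_profit_le (φ b π' π : ℝ) :
    (RoyaltyContract.linearRoyalty φ b).profit π' π ≤
      (RoyaltyContract.linearRoyalty φ b).profit π π := by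
  simp only [RoyaltyContract.profit, RoyaltyContract.linearRoyalty]
  linarith

theorem integral_netShare_eq_const {a b s : ℝ} (hab : a ≤ b)
    (hs : ∀ z ∈ Ioc a b, M.netShare z = s) : ∫ z in a..b, M.netShare z = s * (b - a) := by
  rw [intervalIntegral.integral_of_le hab, setIntegral_congr_fun measurableSet_Ioc hs,
    ← intervalIntegral.integral_of_le hab, intervalIntegral.integral_const, smul_eq_mul, mul_comm]

theorem integral_netShare_of_le_θZero {θ : ℝ} (h1 : M.θlo ≤ θ) (h2 : θ ≤ M.θZero) :
    ∫ z in M.θlo..θ, M.netShare z = 0 := by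
  rw [integral_netShare_eq_const h1 (s := 0) fun z hz => if_pos (hz.2.trans h2), zero_mul]

theorem integral_netShare_of_le_θStar (h0 : M.θlo ≤ M.θZero) {θ : ℝ} (h1 : M.θZero ≤ θ)
    (h2 : θ ≤ M.θStar) : ∫ z in M.θlo..θ, M.netShare z = (1 - M.φ) * (θ - M.θZero) := by
  rw [← intervalIntegral.integral_add_adjacent_intervals
    (netShare_intervalIntegrable M.θlo M.θZero) (netShare_intervalIntegrable M.θZero θ),
    integral_netShare_of_le_θZero h0 le_rfl, zero_add]
  refine integral_netShare_eq_const h1 fun z hz => ?_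
  rw [netShare, if_neg (not_le.2 hz.1), if_pos (hz.2.trans h2)]

theorem integral_netShare_of_ge {a θ : ℝ} (h0 : M.θZero ≤ a) (h1 : M.θStar ≤ a) (h2 : a ≤ θ) :
    ∫ z in a..θ, M.netShare z = θ - a := by
  rw [integral_netShare_eq_const h2 (s := 1), one_mul]
  intro z hz
  rw [netShare, if_neg (not_le.2 (h0.trans_lt hz.1)), if_neg (not_le.2 (h1.trans_lt hz.1))]

theorem Regular.star_none (hreg : M.Regular) (hadd : M.AdditiveErrors εlo εhi h) {θ : ℝ}
    (hθ : θ ∈ M.types) (hne : θ ≠ M.θlo) (hle : θ ≤ M.θZero) :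
    M.star.q θ = 0 ∧ M.star.t θ = 0 := by
  have hq : M.qStar θ = 0 := by rw [hreg.qStar_eq hadd hθ hne, if_neg (not_lt.2 hle)]
  refine ⟨hq, ?_⟩
  change M.tStar θ = 0
  rw [hadd.tStar_eq hθ, hq, hreg.integral_netShare hadd hθ, integral_netShare_of_le_θZero hθ.1 hle]
  ring

/-- The transfer is determined by the rent: a buyer who keeps his whole income and has rent `θ - b`
pays `b`. -/
theorem Regular.star_lumpSum (hreg : M.Regular) (hadd : M.AdditiveErrors εlo εhi h) {θ : ℝ}
    (hθ : θ ∈ M.types) (hne : θ ≠ M.θlo) (hZ : M.θZero < θ) (hS : M.θStar < θ) {b : ℝ}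
    (hb : ∫ z in M.θlo..θ, M.netShare z = θ - b) :
    M.star.q θ = 1 ∧ M.star.t θ = (RoyaltyContract.lumpSum b).price ∧
    ∀ π' ∈ M.incomes θ, M.star.r θ π' = (RoyaltyContract.lumpSum b).royalty π' ∧
      M.star.a θ π' = (RoyaltyContract.lumpSum b).audit π' ∧
      (M.star.a θ π' ≠ 0 → ∀ π ∈ M.allIncomes,
        M.star.p θ π' π = (RoyaltyContract.lumpSum b).penalty π' π) := by
  have hq : M.qStar θ = 1 := by rw [hreg.qStar_eq hadd hθ hne, if_pos hZ]
  have hk : M.auditGain θ < 0 :=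
    not_le.1 fun hk => not_le.2 hS ((hreg.auditGain_nonneg_iff hadd hθ hne).1 hk)
  have hΦ := hadd.Φ_of_neg hθ hk
  have ha : ∀ π' ∈ M.incomes θ, M.aStar θ π' = 0 := by
    intro π' hπ'
    -- Above the lowest type all incomes are positive, so the audited report of zero is not
    -- available.
    have hlo : 0 < M.πlo θ := by
      rw [hadd.πlo_eq θ hθ]
      linarith [hadd.εlo_ge, lt_of_le_of_ne hθ.1 hne.symm]
    rw [hadd.aStar_of_neg hθ hk, if_neg (not_le.2 (hlo.trans_le hπ'.1))]
  refine ⟨hq, ?_, fun π' hπ' => ⟨?_, ha π' hπ', fun hne' => absurd (ha π' hπ') hne'⟩⟩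
  · change M.tStar θ = b
    rw [hadd.tStar_eq hθ, hq, hΦ, hreg.integral_netShare hadd hθ, hb]
    ring
  · change M.rStar θ π' = 0
    rw [hadd.rStar_eq hθ hπ', hΦ, zero_mul]

theorem Regular.star_linearRoyalty (hreg : M.Regular) (hadd : M.AdditiveErrors εlo εhi h) {θ : ℝ}
    (hθ : θ ∈ M.types) (hne : θ ≠ M.θlo) (hZ : M.θZero < θ) (hS : θ ≤ M.θStar) {b : ℝ}
    (hb : ∫ z in M.θlo..θ, M.netShare z = (1 - M.φ) * θ - b) :
    M.star.q θ = 1 ∧ M.star.t θ = (RoyaltyContract.linearRoyalty M.φ b).price ∧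
    ∀ π' ∈ M.incomes θ, M.star.r θ π' = (RoyaltyContract.linearRoyalty M.φ b).royalty π' ∧
      M.star.a θ π' = (RoyaltyContract.linearRoyalty M.φ b).audit π' ∧
      (M.star.a θ π' ≠ 0 → ∀ π ∈ M.allIncomes,
        M.star.p θ π' π = (RoyaltyContract.linearRoyalty M.φ b).penalty π' π) := by
  have hq : M.qStar θ = 1 := by rw [hreg.qStar_eq hadd hθ hne, if_pos hZ]
  have hk : 0 ≤ M.auditGain θ := (hreg.auditGain_nonneg_iff hadd hθ hne).2 hS
  have hΦ := hadd.Φ_of_nonneg hθ hk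
  refine ⟨hq, ?_, fun π' hπ' => ⟨?_, hadd.aStar_of_nonneg hθ hk hπ', fun _ _ _ => rfl⟩⟩
  · change M.tStar θ = b
    rw [hadd.tStar_eq hθ, hq, hΦ, hreg.integral_netShare hadd hθ, hb]
    ring
  · change M.rStar θ π' = π' * M.φ
    rw [hadd.rStar_eq hθ hπ', hΦ, mul_comm]

theorem Regular.implements_lumpSum (hreg : M.Regular) (hadd : M.AdditiveErrors εlo εhi h)
    (hcut : M.θStar ≤ M.θZero) :
    M.Implements {RoyaltyContract.lumpSum M.θZero}
      (fun θ => if θ ≤ M.θZero then none else some (RoyaltyContract.lumpSum M.θZero)) M.star where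
  optimal :=
    { available := by
        intro θ _ C hC
        split_ifs at hC
        exact (Option.some.inj hC).symm
      truthful := by
        rintro C rfl π _ π' _
        exact lumpSum_profit_le _ _ _
      outside := by
        intro θ hθ
        split_ifs with h1
        · exact le_rfl
        · rw [decisionValue_lumpSum hθ]
          exact sub_nonneg.2 (not_le.1 h1).le
      contract := by
        rintro θ hθ C rfl
        split_ifs with h1
        · rw [decisionValue_lumpSum hθ]
          exact sub_nonpos.2 h1
        · exact le_rfl }
  outcome_none := by
    intro θ hθ hne hσ
    split_ifs at hσ with h1
    exact hreg.star_none hadd hθ hne h1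
  outcome_some := by
    intro θ hθ hne C hσ
    split_ifs at hσ with h1
    obtain rfl := Option.some.inj hσ
    have h2 := not_le.1 h1
    refine hreg.star_lumpSum hadd hθ hne h2 (hcut.trans_lt h2) ?_
    rw [← intervalIntegral.integral_add_adjacent_intervals
      (netShare_intervalIntegrable M.θlo M.θZero) (netShare_intervalIntegrable M.θZero θ),
      integral_netShare_of_le_θZero (θlo_le_θZero hadd) le_rfl,
      integral_netShare_of_ge le_rfl hcut h2.le, zero_add]

/-- The royalty contract is worth `(1 - φ) (θ - θ₀)`, and the lump-sum contract is worth `φ (θ -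
θ*)` more. The signs of these two terms decide every comparison, and the prices make the values
agree with the rent. -/
theorem Regular.implements_pair (hreg : M.Regular) (hadd : M.AdditiveErrors εlo εhi h)
    (hcut : M.θZero < M.θStar) :
    M.Implements
      {RoyaltyContract.lumpSum ((1 - M.φ) * M.θZero + M.φ * M.θStar),
        RoyaltyContract.linearRoyalty M.φ ((1 - M.φ) * M.θZero)}
      (fun θ =>
        if θ ≤ M.θZero then none
        else if θ ≤ M.θStar then
          some (RoyaltyContract.linearRoyalty M.φ ((1 - M.φ) * M.θZero))
        else some (RoyaltyContract.lumpSum ((1 - M.φ) * M.θZero + M.φ * M.θStar)))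
      M.star where
  optimal :=
    { available := by
        intro θ _ C hC
        split_ifs at hC
        · exact Or.inr (Option.some.inj hC).symm
        · exact Or.inl (Option.some.inj hC).symm
      truthful := by
        rintro C (rfl | rfl) π _ π' _
        · exact lumpSum_profit_le _ _ _
        · exact linearRoyalty_profit_le _ _ _ _
      outside := by
        intro θ hθ
        have hφ := M.φ_mem
        split_ifs with h1 h2
        · exact le_rfl
        · rw [decisionValue_linearRoyalty hθ, decisionValue]
          nlinarith [mul_nonneg (sub_nonneg.2 hφ.2) (sub_nonneg.2 (not_le.1 h1).le)]
        · rw [decisionValue_lumpSum hθ, decisionValue]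
          nlinarith [mul_nonneg (sub_nonneg.2 hφ.2) (sub_nonneg.2 (not_le.1 h1).le),
            mul_nonneg hφ.1 (sub_nonneg.2 (not_le.1 h2).le)]
      contract := by
        rintro θ hθ C (rfl | rfl)
        all_goals
          have hφ := M.φ_mem
          split_ifs with h1 h2
        · rw [decisionValue_lumpSum hθ, decisionValue]
          nlinarith [mul_nonneg (sub_nonneg.2 hφ.2) (sub_nonneg.2 h1),
            mul_nonneg hφ.1 (sub_nonneg.2 (h1.trans hcut.le))]
        · rw [decisionValue_lumpSum hθ, decisionValue_linearRoyalty hθ]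
          nlinarith [mul_nonneg hφ.1 (sub_nonneg.2 h2)]
        · exact le_rfl
        · rw [decisionValue_linearRoyalty hθ, decisionValue]
          nlinarith [mul_nonneg (sub_nonneg.2 hφ.2) (sub_nonneg.2 h1)]
        · exact le_rfl
        · rw [decisionValue_lumpSum hθ, decisionValue_linearRoyalty hθ]
          nlinarith [mul_nonneg hφ.1 (sub_nonneg.2 (not_le.1 h2).le)] }
  outcome_none := by
    intro θ hθ hne hσ
    split_ifs at hσ with h1
    exact hreg.star_none hadd hθ hne h1
  outcome_some := by
    intro θ hθ hne C hσ
    have h0 := θlo_le_θZero hadd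
    split_ifs at hσ with h1 h2 <;> obtain rfl := Option.some.inj hσ
    · refine hreg.star_linearRoyalty hadd hθ hne (not_le.1 h1) h2 ?_
      rw [integral_netShare_of_le_θStar h0 (not_le.1 h1).le h2]
      ring
    · refine hreg.star_lumpSum hadd hθ hne (not_le.1 h1) (not_le.1 h2) ?_
      rw [← intervalIntegral.integral_add_adjacent_intervals
        (netShare_intervalIntegrable M.θlo M.θStar) (netShare_intervalIntegrable M.θStar θ),
        integral_netShare_of_le_θStar h0 hcut.le le_rfl,
        integral_netShare_of_ge hcut.le le_rfl (not_le.1 h2).le]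
      ring

end AuctionModel

theorem corollary2 (M : AuctionModel) (εlo : ℝ) (εhi : EReal) (h : ℝ → ℝ)
    (hadd : M.AdditiveErrors εlo εhi h) (hreg : M.Regular) :
    M.IsOptimal M.star ∧
    (M.θStar ≤ M.θZero →
      M.Implements {RoyaltyContract.lumpSum M.θZero}
        (fun θ => if θ ≤ M.θZero then none else some (RoyaltyContract.lumpSum M.θZero))
        M.star) ∧
    (M.θZero < M.θStar →
      M.Implements
        {RoyaltyContract.lumpSum ((1 - M.φ) * M.θZero + M.φ * M.θStar),
          RoyaltyContract.linearRoyalty M.φ ((1 - M.φ) * M.θZero)}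
        (fun θ =>
          if θ ≤ M.θZero then none
          else if θ ≤ M.θStar then
            some (RoyaltyContract.linearRoyalty M.φ ((1 - M.φ) * M.θZero))
          else some (RoyaltyContract.lumpSum ((1 - M.φ) * M.θZero + M.φ * M.θStar)))
        M.star) := by
  exact ⟨hreg.star_isOptimal hadd, hreg.implements_lumpSum hadd, hreg.implements_pair hadd⟩
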